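/- **Notation.** $\Delta_m$ is the probability simplex in $\mathbb{R}^m$. For $r\in\Delta_m$, $c\in\Delta_n$ let $\Pi(r,c)$ be the set of matrices $X\in\mathbb{R}_{\ge 0}^{m\times n}$ with $X\mathbb{1}=r$ and $X^\top\mathbb{1}=c$. Write $\|X\|_1=\sum_{ij}|X_{ij}|$, $\|C\|_\infty=\max_{ij}|C_{ij}|$, $H(X)=-\sum_{ij}X_{ij}\log X_{ij}$ (with $0\log 0=0$), and $b=\min_{i,j}\{r_i,c_j\}$. Exponentials, minima and quotients of matrices and vectors are entrywise. **Algorithms.** All of them compute with exact real numbers. Each arithmetic operation, $\exp$, $\log$, comparison and write of an array entry takes one unit of time. * $\mathtt{Sinkhorn}(K,r,c,\varepsilon')$: put $k=0$, $X_0=K/\|K\|_1$, $u^0=0$, $v^0=0$. While $\|X_k\mathbb{1}-r\|_1+\|X_k^\top\mathbb{1}-c\|_1>\varepsilon'$: increase $k$ by one; if $k$ is odd, put $u^k=u^{k-1}+\log(r/(X_{k-1}\mathbb{1}))$ and $v^k=v^{k-1}$; if $k$ is even, put $v^k=v^{k-1}+\log(c/(X_{k-1}^\top\mathbb{1}))$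 and $u^k=u^{k-1}$; then put $X_k=\operatorname{diag}(e^{u^k})\,K\,\operatorname{diag}(e^{v^k})$. Return $X_k$. * $\mathtt{Round}(F,\Pi(r,c))$: put $F'=\operatorname{diag}(\min(r/(F\mathbb{1}),1))\,F$, then $F''=F'\operatorname{diag}(\min(c/(F'^\top\mathbb{1}),1))$, $e_r=r-F''\mathbb{1}$, $e_c=c-F''^\top\mathbb{1}$. Return $F''+e_re_c^\top/\|e_r\|_1$ (and $F''$ if $e_r=0$). * $\mathtt{ApproxOT}(r,c,C,\xi,\varepsilon)$: restrict $r$, $c$, $C$ to the indices $i,j$ with $r_i>0$, $c_j>0$. With the restricted data, put $J=\xi\|C\|_\infty-\log\min_{i,j}\{r_i,c_j\}$, $K=e^{-\xi C}$, and $\varepsilon'=\varepsilon^2/(8J)$ if the number of rows or of columns exceeds $2$, $\varepsilon'=\varepsilon^2\log 2/(8J)$ otherwise ($\varepsilon'=0$ in the trivial case $J=0$, in which there are only one row and one column). Compute $X'=\mathtt{Sinkhorn}(K,r,c,\varepsilon')$ and $\mathtt{Round}(X',\Pi(r,c))$, and return the latter, extended by zeros to an $m\times n$ matrix $\hat X$.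 **Lemma.** There are universal constants $A\in\mathbb{R}$ and $p\in\mathbb{N}$ such that the following holds for all $m,n$, all $r\in\Delta_m$ and $c\in\Delta_n$ with all entries positive, all $C\in\mathbb{R}_{\ge 0}^{m\times n}$, $\xi>0$ and $\varepsilon\in(0,1)$. The problem of minimizing $\langle X,C\rangle-\frac1\xi H(X)$ over $X\in\Pi(r,c)$ has exactly one solution $X^*_\xi$, and $\mathtt{ApproxOT}(r,c,C,\xi,\varepsilon)$ terminates and returns a coupling $\hat X\in\Pi(r,c)$ with $$\|\hat X-X^*_\xi\|_1\le\varepsilon$$ after a time $T$ with $$T\le A\,(1+\log(mn))^p\Bigl(mn\,\varepsilon^{-4}\,\xi\|C\|_\infty\bigl(\xi^2\|C\|_\infty^2+(\log b^{-1})^2\bigr)+mn\Bigr),$$ that is, in time $\tilde{\mathcal O}\bigl(mn\,\varepsilon^{-4}\xi\|C\|_\infty(\xi^2\|C\|_\infty^2+(\log b^{-1})^2)+mn\bigr)$, where $\tilde{\mathcal O}$ hides only powers of $1+\log(mn)$. -/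

import Mathlib

noncomputable section

namespace EntropicOT

/-! ### Entropic optimal transport -/

/-- The couplings of `r` and `c`: nonnegative matrices with row sums `r` and column sums `c`. -/
def couplings {ι κ : Type} [Fintype ι] [Fintype κ] (r : ι → ℝ) (c : κ → ℝ) : Set (ι → κ → ℝ) :=
  {X | (∀ i j, 0 ≤ X i j) ∧ (∀ i, ∑ j, X i j = r i) ∧ (∀ j, ∑ i, X i j = c j)}

/-- The Shannon entropy `H(X) = -∑ X_ij log X_ij`, with `0 log 0 = 0`. -/
def entropy {ι κ : Type} [Fintype ι] [Fintype κ] (X : ι → κ → ℝ) : ℝ :=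
  -∑ i, ∑ j, X i j * Real.log (X i j)

/-- The objective `⟨X, C⟩ - H(X) / ξ`. -/
def objective {ι κ : Type} [Fintype ι] [Fintype κ] (C : ι → κ → ℝ) (ξ : ℝ) (X : ι → κ → ℝ) : ℝ :=
  (∑ i, ∑ j, X i j * C i j) - 1 / ξ * entropy X

/-- `X` is an optimal solution of the entropic optimal transport problem. -/
def IsOptimal {ι κ : Type} [Fintype ι] [Fintype κ] (r : ι → ℝ) (c : κ → ℝ) (C : ι → κ → ℝ)
    (ξ : ℝ) (X : ι → κ → ℝ) : Prop :=
  X ∈ couplings r c ∧ IsMinOn (objective C ξ) (couplings r c) X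

/-- The entrywise norm `‖X‖₁ = ∑ |X_ij|`. -/
def norm1 {ι κ : Type} [Fintype ι] [Fintype κ] (X : ι → κ → ℝ) : ℝ := ∑ i, ∑ j, |X i j|

/-- The entrywise norm `‖C‖_∞ = max |C_ij|`. -/
def normInf {ι κ : Type} (C : ι → κ → ℝ) : ℝ := ⨆ i, ⨆ j, |C i j|

/-- `min {r_i, c_j}`, the smallest entry of the two vectors. -/
def minEntry {ι κ : Type} (r : ι → ℝ) (c : κ → ℝ) : ℝ := min (⨅ i, r i) (⨅ j, c j)

/-! ### Real-number computations with a step count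

Every arithmetic operation, `exp`, `log`, comparison, and write of an array entry is one step. -/

/-- The result of a terminating computation, with the number of steps it took. -/
structure Timed (α : Type) where
  val : α
  cost : ℕ

instance : Monad Timed where
  pure a := ⟨a, 0⟩
  bind x f := ⟨(f x.val).val, x.cost + (f x.val).cost⟩

namespace Timed

def add (x y : ℝ) : Timed ℝ := ⟨x + y, 1⟩
def sub (x y : ℝ) : Timed ℝ := ⟨x - y, 1⟩
def mul (x y : ℝ) : Timed ℝ := ⟨x * y, 1⟩
def div (x y : ℝ) : Timed ℝ := ⟨x / y, 1⟩
def neg (x : ℝ) : Timed ℝ := ⟨-x, 1⟩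
def abs (x : ℝ) : Timed ℝ := ⟨|x|, 1⟩
def min (x y : ℝ) : Timed ℝ := ⟨Min.min x y, 1⟩
def exp (x : ℝ) : Timed ℝ := ⟨Real.exp x, 1⟩
def log (x : ℝ) : Timed ℝ := ⟨Real.log x, 1⟩
def lt (x y : ℝ) : Timed Bool := ⟨decide (x < y), 1⟩
def natSucc (k : ℕ) : Timed ℕ := ⟨k + 1, 1⟩
def natOdd (k : ℕ) : Timed Bool := ⟨decide (k % 2 = 1), 1⟩
def natMax (k l : ℕ) : Timed ℕ := ⟨Max.max k l, 1⟩
def natLe (k l : ℕ) : Timed Bool := ⟨decide (k ≤ l), 1⟩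

/-- A loop over the index set that computes an array; one extra step per entry for the write. -/
def tabulate {ι α : Type} [Fintype ι] (f : ι → Timed α) : Timed (ι → α) :=
  ⟨fun i => (f i).val, ∑ i, ((f i).cost + 1)⟩

/-- A loop that adds up the values of `f`; one extra step per term for the addition. -/
def sum {ι : Type} [Fintype ι] (f : ι → Timed ℝ) : Timed ℝ :=
  ⟨∑ i, (f i).val, ∑ i, ((f i).cost + 1)⟩

/-- A loop that finds the largest value of `f`; one extra step per term for the comparison. -/
def maximum {ι : Type} [Fintype ι] (f : ι → Timed ℝ) : Timed ℝ :=
  ⟨⨆ i, (f i).val, ∑ i, ((f i).cost + 1)⟩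

/-- A loop that finds the smallest value of `f`; one extra step per term for the comparison. -/
def minimum {ι : Type} [Fintype ι] (f : ι → Timed ℝ) : Timed ℝ :=
  ⟨⨅ i, (f i).val, ∑ i, ((f i).cost + 1)⟩

/-- `WhileRuns test body s s' t`: the loop `while test do body`, started in the state `s`,
terminates in the state `s'` after `t` steps. -/
inductive WhileRuns {σ : Type} (test : σ → Timed Bool) (body : σ → Timed σ) : σ → σ → ℕ → Prop
  | finished (s : σ) (h : (test s).val = false) : WhileRuns test body s s (test s).cost
  | step (s s' : σ) (t : ℕ) (h : (test s).val = true)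
      (hrun : WhileRuns test body (body s).val s' t) :
      WhileRuns test body s s' ((test s).cost + (body s).cost + t)

/-- A loop has at most one result and one running time. -/
theorem WhileRuns.unique {σ : Type} {test : σ → Timed Bool} {body : σ → Timed σ} {s s₁ s₂ : σ}
    {t₁ t₂ : ℕ} (h₁ : WhileRuns test body s s₁ t₁) (h₂ : WhileRuns test body s s₂ t₂) :
    s₁ = s₂ ∧ t₁ = t₂ := by
  induction h₁ generalizing s₂ t₂ with
  | finished s h =>
    cases h₂ with
    | finished => exact ⟨rfl, rfl⟩
    | step _ _ _ h' => simp [h] at h'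
  | step s s' t h _ ih =>
    cases h₂ with
    | finished _ h' => simp [h] at h'
    | step _ _ _ _ hrun =>
      obtain ⟨h1, h2⟩ := ih hrun
      exact ⟨h1, by rw [h2]⟩

end Timed

open Timed

/-! ### Linear algebra subroutines -/

def rowSums {ι κ : Type} [Fintype ι] [Fintype κ] (X : ι → κ → ℝ) : Timed (ι → ℝ) :=
  tabulate fun i => Timed.sum fun j => pure (X i j)

def colSums {ι κ : Type} [Fintype ι] [Fintype κ] (X : ι → κ → ℝ) : Timed (κ → ℝ) :=
  tabulate fun j => Timed.sum fun i => pure (X i j)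

def vecSub {ι : Type} [Fintype ι] (x y : ι → ℝ) : Timed (ι → ℝ) :=
  tabulate fun i => Timed.sub (x i) (y i)

def vecAdd {ι : Type} [Fintype ι] (x y : ι → ℝ) : Timed (ι → ℝ) :=
  tabulate fun i => Timed.add (x i) (y i)

def vecNorm1 {ι : Type} [Fintype ι] (x : ι → ℝ) : Timed ℝ :=
  Timed.sum fun i => Timed.abs (x i)

/-- `log (x_i / y_i)` for all `i`. -/
def logRatio {ι : Type} [Fintype ι] (x y : ι → ℝ) : Timed (ι → ℝ) :=
  tabulate fun i => do
    let q ← Timed.div (x i) (y i)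
    Timed.log q

/-- `min (x_i / y_i) 1` for all `i`. -/
def cappedRatio {ι : Type} [Fintype ι] (x y : ι → ℝ) : Timed (ι → ℝ) :=
  tabulate fun i => do
    let q ← Timed.div (x i) (y i)
    Timed.min q 1

/-- `diag(e^u) K diag(e^v)`. -/
def scaled {ι κ : Type} [Fintype ι] [Fintype κ] (K : ι → κ → ℝ) (u : ι → ℝ) (v : κ → ℝ) :
    Timed (ι → κ → ℝ) := do
  let a ← tabulate fun i => Timed.exp (u i)
  let b ← tabulate fun j => Timed.exp (v j)
  tabulate fun i => tabulate fun j => do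
    let z ← Timed.mul (a i) (K i j)
    Timed.mul z (b j)

/-! ### The algorithm `Sinkhorn` -/

/-- The variables `k, X_k, u^k, v^k`. -/
structure SinkhornState (ι κ : Type) where
  k : ℕ
  X : ι → κ → ℝ
  u : ι → ℝ
  v : κ → ℝ

/-- `k ← 0`, `X_0 ← K / ‖K‖₁`, `u^0 ← 0`, `v^0 ← 0`. -/
def sinkhornInit {ι κ : Type} [Fintype ι] [Fintype κ] (K : ι → κ → ℝ) :
    Timed (SinkhornState ι κ) := do
  let s ← Timed.sum fun i => Timed.sum fun j => Timed.abs (K i j)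
  let X ← tabulate fun i => tabulate fun j => Timed.div (K i j) s
  let u ← tabulate fun _ => pure 0
  let v ← tabulate fun _ => pure 0
  pure ⟨0, X, u, v⟩

/-- The loop condition `‖X_k 1 - r‖₁ + ‖X_kᵀ 1 - c‖₁ > ε'`. -/
def sinkhornTest {ι κ : Type} [Fintype ι] [Fintype κ] (r : ι → ℝ) (c : κ → ℝ) (ε' : ℝ)
    (s : SinkhornState ι κ) : Timed Bool := do
  let r' ← rowSums s.X
  let c' ← colSums s.X
  let dr ← vecSub r' r
  let dc ← vecSub c' c
  let er ← vecNorm1 dr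
  let ec ← vecNorm1 dc
  let e ← Timed.add er ec
  Timed.lt ε' e

/-- The loop body: `k ← k + 1`, then the row potential is updated if `k` is odd and the column
potential if `k` is even, then `X_k ← diag(e^{u^k}) K diag(e^{v^k})`. -/
def sinkhornBody {ι κ : Type} [Fintype ι] [Fintype κ] (K : ι → κ → ℝ) (r : ι → ℝ) (c : κ → ℝ)
    (s : SinkhornState ι κ) : Timed (SinkhornState ι κ) := do
  let k ← natSucc s.k
  let isOdd ← natOdd k
  if isOdd then
    let r' ← rowSums s.X
    let w ← logRatio r r'
    let u ← vecAdd s.u w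
    let X ← scaled K u s.v
    pure ⟨k, X, u, s.v⟩
  else
    let c' ← colSums s.X
    let w ← logRatio c c'
    let v ← vecAdd s.v w
    let X ← scaled K s.u v
    pure ⟨k, X, s.u, v⟩

/-- `Sinkhorn(K, r, c, ε')` terminates, returns `X`, and takes `t` steps. -/
def SinkhornRuns {ι κ : Type} [Fintype ι] [Fintype κ] (K : ι → κ → ℝ) (r : ι → ℝ) (c : κ → ℝ)
    (ε' : ℝ) (X : ι → κ → ℝ) (t : ℕ) : Prop :=
  ∃ (s : SinkhornState ι κ) (tl : ℕ),
    WhileRuns (sinkhornTest r c ε') (sinkhornBody K r c) (sinkhornInit K).val s tl ∧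
    X = s.X ∧ t = (sinkhornInit K).cost + tl

/-! ### The algorithm `Round` -/

/-- `Round(F, Π(r, c))`. If `err_r = 0`, the quotient in the last line is read as `0`. -/
def round {ι κ : Type} [Fintype ι] [Fintype κ] (F : ι → κ → ℝ) (r : ι → ℝ) (c : κ → ℝ) :
    Timed (ι → κ → ℝ) := do
  let r' ← rowSums F
  let x ← cappedRatio r r'
  let F' ← tabulate fun i => tabulate fun j => Timed.mul (x i) (F i j)
  let c' ← colSums F'
  let y ← cappedRatio c c'
  let F'' ← tabulate fun i => tabulate fun j => Timed.mul (F' i j) (y j)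
  let r'' ← rowSums F''
  let c'' ← colSums F''
  let errR ← vecSub r r''
  let errC ← vecSub c c''
  let N ← vecNorm1 errR
  tabulate fun i => tabulate fun j => do
    let p ← Timed.mul (errR i) (errC j)
    let q ← Timed.div p N
    Timed.add (F'' i j) q

/-! ### The algorithm `ApproxOT` -/

/-- The set of indices of the positive entries of `r`. -/
abbrev Pos {m : ℕ} (r : Fin m → ℝ) : Type := {i : Fin m // 0 < r i}

/-- The data with which `Sinkhorn` and `Round` are called. -/
structure Restricted {m n : ℕ} (r : Fin m → ℝ) (c : Fin n → ℝ) where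
  rPos : Pos r → ℝ
  cPos : Pos c → ℝ
  K : Pos r → Pos c → ℝ
  ε' : ℝ

/-- Restriction to the positive entries of the marginals, and choice of the parameters
`J = ξ ‖C‖_∞ - log min {r_i, c_j}`, `K = exp(-ξ C)` and `ε' = ε² / (8 J)`
(`ε' = ε² log 2 / (8 J)` if there are at most two rows and at most two columns). -/
def prepare {m n : ℕ} (r : Fin m → ℝ) (c : Fin n → ℝ) (C : Fin m → Fin n → ℝ) (ξ ε : ℝ) :
    Timed (Restricted r c) := do
  -- the scans that find the positive entries
  let _ ← tabulate fun i => Timed.lt 0 (r i)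
  let _ ← tabulate fun j => Timed.lt 0 (c j)
  let rPos ← tabulate fun i : Pos r => pure (r i)
  let cPos ← tabulate fun j : Pos c => pure (c j)
  let CPos ← tabulate fun i : Pos r => tabulate fun j : Pos c => pure (C i j)
  -- the parameters
  let M ← Timed.maximum fun i => Timed.maximum fun j => Timed.abs (CPos i j)
  let bR ← Timed.minimum fun i => pure (rPos i)
  let bC ← Timed.minimum fun j => pure (cPos j)
  let b ← Timed.min bR bC
  let lb ← Timed.log b
  let ξM ← Timed.mul ξ M
  let J ← Timed.sub ξM lb
  let J8 ← Timed.mul 8 J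
  let ε2 ← Timed.mul ε ε
  let e ← Timed.div ε2 J8
  let d ← natMax (Fintype.card (Pos r)) (Fintype.card (Pos c))
  let isSmall ← natLe d 2
  let l2 ← Timed.log 2
  let eSmall ← Timed.mul e l2
  let K ← tabulate fun i => tabulate fun j => do
    let z ← Timed.mul ξ (CPos i j)
    let w ← Timed.neg z
    Timed.exp w
  pure ⟨rPos, cPos, K, if isSmall then eSmall else e⟩

/-- Extension by zero of a matrix on the positive entries. -/
def extend {m n : ℕ} (r : Fin m → ℝ) (c : Fin n → ℝ) (X : Pos r → Pos c → ℝ) :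
    Timed (Fin m → Fin n → ℝ) :=
  tabulate fun i => tabulate fun j =>
    pure (if h : 0 < r i ∧ 0 < c j then X ⟨i, h.1⟩ ⟨j, h.2⟩ else 0)

/-- `Round` followed by the extension by zero. -/
def finish {m n : ℕ} (r : Fin m → ℝ) (c : Fin n → ℝ) (D : Restricted r c)
    (X : Pos r → Pos c → ℝ) : Timed (Fin m → Fin n → ℝ) := do
  let Y ← round X D.rPos D.cPos
  extend r c Y

/-- `ApproxOT(r, c, C, ξ, ε)` terminates, returns `X`, and takes `T` steps. -/
def ApproxOTRuns {m n : ℕ} (r : Fin m → ℝ) (c : Fin n → ℝ) (C : Fin m → Fin n → ℝ) (ξ ε : ℝ)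
    (X : Fin m → Fin n → ℝ) (T : ℕ) : Prop :=
  ∃ (X' : Pos r → Pos c → ℝ) (t : ℕ),
    SinkhornRuns (prepare r c C ξ ε).val.K (prepare r c C ξ ε).val.rPos
      (prepare r c C ξ ε).val.cPos (prepare r c C ξ ε).val.ε' X' t ∧
    X = (finish r c (prepare r c C ξ ε).val X').val ∧
    T = (prepare r c C ξ ε).cost + t + (finish r c (prepare r c C ξ ε).val X').cost

end EntropicOT

end

/-!
Write `J = ξ ‖C‖_∞ - log min {r_i, c_j}`. Every iterate `diag(e^u) K diag(e^v)` of `Sinkhorn` has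
potentials `u`, `v` that oscillate by at most `J`, and so has the optimal coupling. For two scalings
of the same kernel the sum of the two relative entropies is linear in the differences of the
potentials, so Pinsker's inequality bounds their squared `‖·‖₁`-distance by `J` times the marginal
error. The relative entropy of `r cᵀ` with respect to the iterates is at most `O(ξ ‖C‖_∞)` at
the start and drops in each step by at least a multiple of the squared marginal error, so that
error `δ` is reached after `O(ξ ‖C‖_∞ / δ²)` steps, and `Round` moves the last iterate by at most
`3 δ`. The optimal coupling itself exists because the potentials of the iterates stay in a compact
set, on which the marginal error attains its infimum `0`.
-/

noncomputable section

namespace EntropicOT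

open Function Real

/-! ### Relative entropy -/

section RelativeEntropy

theorem hasDerivAt_log_sub_rational {x : ℝ} (hx : 0 < x) :
    HasDerivAt (fun y => log y - (y - 1) * (5 * y + 1) / (2 * y * (y + 2)))
      ((x - 1) ^ 3 / (x ^ 2 * (x + 2) ^ 2)) x := by
  have hnum : HasDerivAt (fun y : ℝ => (y - 1) * (5 * y + 1)) (10 * x - 4) x := by
    refine (((hasDerivAt_id x).sub_const 1).mul
      (((hasDerivAt_id x).const_mul 5).add_const 1)).congr_deriv ?_
    simp only [id]
    ring
  have hden : HasDerivAt (fun y : ℝ => 2 * y * (y + 2)) (4 * x + 4) x := by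
    refine (((hasDerivAt_id x).const_mul 2).mul ((hasDerivAt_id x).add_const 2)).congr_deriv ?_
    simp only [id]
    ring
  refine ((hasDerivAt_log hx.ne').sub (hnum.div hden (by positivity))).congr_deriv ?_
  field_simp
  ring

theorem rational_le_log {x : ℝ} (hx : 0 < x) :
    (x - 1) * (5 * x + 1) / (2 * x * (x + 2)) ≤ log x := by
  set f : ℝ → ℝ := fun y => log y - (y - 1) * (5 * y + 1) / (2 * y * (y + 2))
  have hderiv : ∀ y, 0 < y → HasDerivAt f ((y - 1) ^ 3 / (y ^ 2 * (y + 2) ^ 2)) y :=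
    fun _ => hasDerivAt_log_sub_rational
  have hmin : IsMinOn f (Set.Ioi 0) 1 := by
    have hdiff : ∀ y, 0 < y → DifferentiableAt ℝ f y := fun y hy => (hderiv y hy).differentiableAt
    refine isMinOn_Ioi_of_deriv (hdiff 1 one_pos).continuousAt
      (fun y hy => (hdiff y hy.1).differentiableWithinAt)
      (fun y hy => (hdiff y (one_pos.trans hy)).differentiableWithinAt) (fun y hy => ?_)
      (fun y hy => ?_)
    · rw [(hderiv y hy.1).deriv]
      have hy1 : y - 1 ≤ 0 := by linarith [hy.2]
      exact div_nonpos_of_nonpos_of_nonneg (Odd.pow_nonpos (by decide) hy1) (by positivity)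
    · have hy1 : 0 ≤ y - 1 := sub_nonneg.2 (le_of_lt hy)
      rw [(hderiv y (one_pos.trans hy)).deriv]
      positivity
  have hle : f 1 ≤ f x := hmin hx
  simp only [f, log_one, sub_self, zero_mul, zero_div] at hle
  linarith

theorem sq_sub_div_le_mul_log_sub_log {p q : ℝ} (hp : 0 ≤ p) (hq : 0 < q) :
    3 / 2 * ((p - q) ^ 2 / (p + 2 * q)) ≤ p * (log p - log q) - p + q := by
  obtain rfl | hp := hp.eq_or_lt
  · have : 3 / 2 * ((0 - q) ^ 2 / (0 + 2 * q)) = 3 / 4 * q := by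
      field_simp
      ring
    linarith
  · have h := mul_le_mul_of_nonneg_left (rational_le_log (div_pos hp hq)) hp.le
    rw [log_div hp.ne' hq.ne'] at h
    have heq : p * ((p / q - 1) * (5 * (p / q) + 1) / (2 * (p / q) * (p / q + 2))) =
        3 / 2 * ((p - q) ^ 2 / (p + 2 * q)) + p - q := by
      field_simp
      ring
    linarith

variable {α : Type*} [Fintype α] {p q : α → ℝ}

/-- The relative entropy `∑ p log (p / q)` of `p` with respect to a positive `q`. The logarithm of
the quotient is expanded, so that the formula is also correct where `p` vanishes. -/
def relEntropy (p q : α → ℝ) : ℝ := ∑ a, p a * (log (p a) - log (q a))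

/-- Pinsker's inequality. By the Cauchy-Schwarz inequality in the form
`(∑ f)² / ∑ g ≤ ∑ f² / g`, it follows from the pointwise bound because `∑ (p + 2 q) = 3`. -/
theorem sq_sum_abs_sub_le_two_mul_relEntropy (hp : p ∈ stdSimplex ℝ α) (hq : q ∈ stdSimplex ℝ α)
    (hq0 : ∀ a, 0 < q a) : (∑ a, |p a - q a|) ^ 2 ≤ 2 * relEntropy p q := by
  have hsum : ∑ a, (p a + 2 * q a) = 3 := by
    rw [Finset.sum_add_distrib, ← Finset.mul_sum, hp.2, hq.2]
    norm_num
  calc (∑ a, |p a - q a|) ^ 2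
      = 3 * ((∑ a, |p a - q a|) ^ 2 / ∑ a, (p a + 2 * q a)) := by rw [hsum]; ring
    _ ≤ 3 * ∑ a, |p a - q a| ^ 2 / (p a + 2 * q a) := by
        gcongr
        exact Finset.sq_sum_div_le_sum_sq_div _ _ fun a _ => by linarith [hp.1 a, hq0 a]
    _ = 2 * ∑ a, 3 / 2 * ((p a - q a) ^ 2 / (p a + 2 * q a)) := by
        simp_rw [sq_abs, ← Finset.mul_sum]
        ring
    _ ≤ 2 * ∑ a, (p a * (log (p a) - log (q a)) - p a + q a) := by
        gcongr with a
        exact sq_sub_div_le_mul_log_sub_log (hp.1 a) (hq0 a)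
    _ = 2 * relEntropy p q := by
        rw [Finset.sum_add_distrib, Finset.sum_sub_distrib, hp.2, hq.2, relEntropy]
        ring

theorem relEntropy_nonneg (hp : p ∈ stdSimplex ℝ α) (hq : q ∈ stdSimplex ℝ α)
    (hq0 : ∀ a, 0 < q a) : 0 ≤ relEntropy p q := by
  linarith [sq_nonneg (∑ a, |p a - q a|), sq_sum_abs_sub_le_two_mul_relEntropy hp hq hq0]

variable {ι κ : Type*} [Fintype ι] [Fintype κ] {X : ι → κ → ℝ}

theorem relEntropy_uncurry (X Y : ι → κ → ℝ) :
    relEntropy (uncurry X) (uncurry Y) = ∑ i, ∑ j, X i j * (log (X i j) - log (Y i j)) :=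
  Fintype.sum_prod_type _

theorem uncurry_mem_stdSimplex (hX : ∀ i j, 0 ≤ X i j) (hsum : ∑ i, ∑ j, X i j = 1) :
    uncurry X ∈ stdSimplex ℝ (ι × κ) :=
  ⟨fun z => hX z.1 z.2, (Fintype.sum_prod_type _).trans hsum⟩

end RelativeEntropy

/-! ### Scalings of a matrix -/

section Scaling

variable {ι κ : Type*} {K X : ι → κ → ℝ} {u : ι → ℝ} {v : κ → ℝ}

/-- `X = diag(e^u) K diag(e^v)`: the matrix `X` is the scaling of `K` with potentials `u`, `v`. -/
def IsScaling (K : ι → κ → ℝ) (u : ι → ℝ) (v : κ → ℝ) (X : ι → κ → ℝ) : Prop :=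
  ∀ i j, X i j = exp (u i) * K i j * exp (v j)

theorem IsScaling.pos (hX : IsScaling K u v X) (hK : ∀ i j, 0 < K i j) (i : ι) (j : κ) :
    0 < X i j := by
  rw [hX i j]
  exact mul_pos (mul_pos (exp_pos _) (hK i j)) (exp_pos _)

theorem IsScaling.log_apply (hX : IsScaling K u v X) (hK : ∀ i j, 0 < K i j) (i : ι) (j : κ) :
    log (X i j) = u i + log (K i j) + v j := by
  rw [hX i j, log_mul (mul_pos (exp_pos _) (hK i j)).ne' (exp_pos _).ne',
    log_mul (exp_pos _).ne' (hK i j).ne', log_exp, log_exp]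

theorem IsScaling.flip (hX : IsScaling K u v X) : IsScaling (flip K) v u (flip X) := fun j i => by
  simp only [Function.flip_def, hX i j]
  ring

theorem IsScaling.mul_rows (hX : IsScaling K u v X) {w : ι → ℝ} (hw : ∀ i, 0 < w i) :
    IsScaling K (fun i => u i + log (w i)) v (fun i j => w i * X i j) := fun i j => by
  simp only [hX i j, exp_add, exp_log (hw i)]
  ring

end Scaling

section Oscillation

variable {α : Type*} {x y : α → ℝ} {J J' : ℝ}

/-- The oscillation `max x - min x` of the vector `x` is at most `J`. -/
def OscLE (x : α → ℝ) (J : ℝ) : Prop := ∀ a b, x a - x b ≤ J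

theorem OscLE.sub (hx : OscLE x J) (hy : OscLE y J') : OscLE (fun a => x a - y a) (J + J') :=
  fun a b => by linarith [hx a b, hy b a]

theorem OscLE.add_const (hx : OscLE x J) (t : ℝ) : OscLE (fun a => x a + t) J := fun a b => by
  linarith [hx a b]

/-- Subtracting the midrange from `x` does not change the sum and bounds the entries by `J`. -/
theorem sum_mul_le_of_oscLE [Fintype α] {w : α → ℝ} (hw : ∑ a, w a = 0) (hx : OscLE x (2 * J)) :
    ∑ a, w a * x a ≤ J * ∑ a, |w a| := by
  cases isEmpty_or_nonempty α
  · simp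
  obtain ⟨top, htop⟩ := Finite.exists_max x
  obtain ⟨bot, hbot⟩ := Finite.exists_min x
  set mid := (x top + x bot) / 2 with hmid
  have hcentered : ∀ a, |x a - mid| ≤ J := fun a => by
    rw [abs_le]
    constructor <;> linarith [htop a, hbot a, hx top bot]
  calc ∑ a, w a * x a = ∑ a, w a * (x a - mid) := by
        simp_rw [mul_sub, Finset.sum_sub_distrib, ← Finset.sum_mul, hw, zero_mul, sub_zero]
    _ ≤ ∑ a, J * |w a| := Finset.sum_le_sum fun a _ => by
        calc w a * (x a - mid) ≤ |w a| * |x a - mid| := (le_abs_self _).trans_eq (abs_mul _ _)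
          _ ≤ J * |w a| := by
              rw [mul_comm J]
              gcongr
              exact hcentered a
    _ = J * ∑ a, |w a| := (Finset.mul_sum ..).symm

end Oscillation

/-! ### Marginal errors -/

section MarginalError

variable {ι κ : Type} [Fintype ι] [Fintype κ] {X Y Z : ι → κ → ℝ} {r : ι → ℝ} {c : κ → ℝ}

theorem norm1_sub_le (X Y Z : ι → κ → ℝ) :
    norm1 (fun i j => X i j - Z i j) ≤
      norm1 (fun i j => X i j - Y i j) + norm1 (fun i j => Y i j - Z i j) := by
  simp only [norm1, ← Finset.sum_add_distrib]
  gcongr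
  exact abs_sub_le _ _ _

/-- The quantity `‖X 1 - r‖₁ + ‖Xᵀ 1 - c‖₁` tested by `Sinkhorn`. -/
def marginalError (r : ι → ℝ) (c : κ → ℝ) (X : ι → κ → ℝ) : ℝ :=
  ∑ i, |∑ j, X i j - r i| + ∑ j, |∑ i, X i j - c j|

theorem marginalError_nonneg : 0 ≤ marginalError r c X := by
  unfold marginalError
  positivity

theorem marginalError_flip : marginalError c r (flip X) = marginalError r c X := add_comm _ _

theorem mem_couplings_iff_marginalError_eq_zero :
    X ∈ couplings r c ↔ (∀ i j, 0 ≤ X i j) ∧ marginalError r c X = 0 := by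
  have hrow : 0 ≤ ∑ i, |∑ j, X i j - r i| := by positivity
  have hcol : 0 ≤ ∑ j, |∑ i, X i j - c j| := by positivity
  rw [marginalError, add_eq_zero_iff_of_nonneg hrow hcol,
    Finset.sum_eq_zero_iff_of_nonneg fun _ _ => abs_nonneg _,
    Finset.sum_eq_zero_iff_of_nonneg fun _ _ => abs_nonneg _]
  simp only [couplings, Set.mem_ofPred_eq, Finset.mem_univ, abs_eq_zero, sub_eq_zero, true_imp_iff]

theorem sum_abs_row_sums_sub_le (X Y : ι → κ → ℝ) (r : ι → ℝ) :
    ∑ i, |∑ j, X i j - r i| ≤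
      norm1 (fun i j => X i j - Y i j) + ∑ i, |∑ j, Y i j - r i| := by
  simp only [norm1, ← Finset.sum_add_distrib]
  refine Finset.sum_le_sum fun i _ => ?_
  calc |∑ j, X i j - r i| ≤ |∑ j, X i j - ∑ j, Y i j| + |∑ j, Y i j - r i| := abs_sub_le _ _ _
    _ ≤ ∑ j, |X i j - Y i j| + |∑ j, Y i j - r i| := by
        gcongr
        rw [← Finset.sum_sub_distrib]
        exact Finset.abs_sum_le_sum_abs _ _

theorem norm1_flip : norm1 (flip X) = norm1 X := Finset.sum_comm

theorem marginalError_le (X Y : ι → κ → ℝ) (r : ι → ℝ) (c : κ → ℝ) :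
    marginalError r c X ≤ 2 * norm1 (fun i j => X i j - Y i j) + marginalError r c Y := by
  have hrow := sum_abs_row_sums_sub_le X Y r
  have hcol := sum_abs_row_sums_sub_le (flip X) (flip Y) c
  have hflip : norm1 (fun j i => flip X j i - flip Y j i) = norm1 (fun i j => X i j - Y i j) :=
    norm1_flip
  rw [hflip] at hcol
  simp only [flip_def] at hcol
  unfold marginalError
  linarith

theorem two_mul_abs_sum_sub_one_le (hr : ∑ i, r i = 1) (hc : ∑ j, c j = 1) :
    2 * |∑ i, ∑ j, X i j - 1| ≤ marginalError r c X := by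
  have hrow : |∑ i, ∑ j, X i j - 1| ≤ ∑ i, |∑ j, X i j - r i| := by
    rw [← hr, ← Finset.sum_sub_distrib]
    exact Finset.abs_sum_le_sum_abs _ _
  have hcol : |∑ i, ∑ j, X i j - 1| ≤ ∑ j, |∑ i, X i j - c j| := by
    rw [← hc, Finset.sum_comm, ← Finset.sum_sub_distrib]
    exact Finset.abs_sum_le_sum_abs _ _
  unfold marginalError
  linarith

/-- The matrix `X / ‖X‖₁` for a nonnegative `X`. -/
def normalize (X : ι → κ → ℝ) (i : ι) (j : κ) : ℝ := X i j / ∑ i, ∑ j, X i j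

theorem sum_normalize (hX : ∑ i, ∑ j, X i j ≠ 0) : ∑ i, ∑ j, normalize X i j = 1 := by
  simp_rw [normalize, ← Finset.sum_div]
  exact div_self hX

theorem normalize_const_mul {t : ℝ} (ht : t ≠ 0) :
    normalize (fun i j => t * X i j) = normalize X := by
  funext i j
  simp_rw [normalize, ← Finset.mul_sum]
  exact mul_div_mul_left _ _ ht

theorem norm1_sub_normalize (hX : ∀ i j, 0 ≤ X i j) (hsum : 0 < ∑ i, ∑ j, X i j) :
    norm1 (fun i j => X i j - normalize X i j) = |∑ i, ∑ j, X i j - 1| := by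
  unfold norm1 normalize
  set S := ∑ i, ∑ j, X i j with hS
  have hterm : ∀ i j, |X i j - X i j / S| = |S - 1| / S * X i j := fun i j => by
    have : X i j - X i j / S = (S - 1) / S * X i j := by field_simp
    rw [this, abs_mul, abs_div, abs_of_pos hsum, abs_of_nonneg (hX i j)]
  simp_rw [hterm, ← Finset.mul_sum, ← hS]
  exact div_mul_cancel₀ _ hsum.ne'

theorem marginalError_normalize_le (hX : ∀ i j, 0 ≤ X i j) (hsum : 0 < ∑ i, ∑ j, X i j)
    (hr : ∑ i, r i = 1) (hc : ∑ j, c j = 1) :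
    marginalError r c (normalize X) ≤ 2 * marginalError r c X := by
  have hdist : norm1 (fun i j => normalize X i j - X i j) = |∑ i, ∑ j, X i j - 1| := by
    rw [← norm1_sub_normalize hX hsum]
    simp only [norm1, abs_sub_comm]
  linarith [marginalError_le (normalize X) X r c, two_mul_abs_sum_sub_one_le (X := X) hr hc]

end MarginalError

/-! ### Stability and optimality of scalings with prescribed marginals -/

section Stability

variable {ι κ : Type} [Fintype ι] [Fintype κ] {K C X Y : ι → κ → ℝ} {u u' : ι → ℝ} {v v' : κ → ℝ}
  {r : ι → ℝ} {c : κ → ℝ} {J ξ : ℝ}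

theorem sum_eq_one_of_mem_couplings (hX : X ∈ couplings r c) (hr : ∑ i, r i = 1) :
    ∑ i, ∑ j, X i j = 1 := by
  simp_rw [hX.2.1, hr]

theorem sum_sub_mul_add (X Y : ι → κ → ℝ) (u : ι → ℝ) (v : κ → ℝ) :
    ∑ i, ∑ j, (X i j - Y i j) * (u i + v j) =
      ∑ i, (∑ j, X i j - ∑ j, Y i j) * u i + ∑ j, (∑ i, X i j - ∑ i, Y i j) * v j := by
  simp_rw [mul_add, Finset.sum_add_distrib, ← Finset.sum_sub_distrib, Finset.sum_mul]
  rw [Finset.sum_comm (f := fun i j => (X i j - Y i j) * v j)]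

theorem sq_norm1_sub_le_two_mul_relEntropy (hX : uncurry X ∈ stdSimplex ℝ (ι × κ))
    (hY : uncurry Y ∈ stdSimplex ℝ (ι × κ)) (hpos : ∀ i j, 0 < Y i j) :
    norm1 (fun i j => X i j - Y i j) ^ 2 ≤ 2 * relEntropy (uncurry X) (uncurry Y) := by
  have hnorm : norm1 (fun i j => X i j - Y i j) = ∑ z, |uncurry X z - uncurry Y z| :=
    (Fintype.sum_prod_type fun z => |uncurry X z - uncurry Y z|).symm
  rw [hnorm]
  exact sq_sum_abs_sub_le_two_mul_relEntropy hX hY fun z => hpos z.1 z.2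

/-- The logarithm of `Y / X` is the sum of a function of `i` and one of `j`, and therefore the
symmetrised relative entropy depends on `Y - X` only through its marginals. -/
theorem relEntropy_add_relEntropy_of_isScaling (hK : ∀ i j, 0 < K i j) (hY : IsScaling K u v Y)
    (hX : IsScaling K u' v' X) :
    relEntropy (uncurry Y) (uncurry X) + relEntropy (uncurry X) (uncurry Y) =
      ∑ i, (∑ j, Y i j - ∑ j, X i j) * (u i - u' i) +
        ∑ j, (∑ i, Y i j - ∑ i, X i j) * (v j - v' j) := by
  simp_rw [← sum_sub_mul_add Y X (fun i => u i - u' i) fun j => v j - v' j, relEntropy_uncurry,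
    ← Finset.sum_add_distrib, hY.log_apply hK, hX.log_apply hK]
  refine Finset.sum_congr rfl fun i _ => Finset.sum_congr rfl fun j _ => ?_
  ring

theorem sq_norm1_sub_le_of_isScaling (hK : ∀ i j, 0 < K i j) (hY : IsScaling K u v Y)
    (hX : IsScaling K u' v' X) (hu : OscLE u J) (hv : OscLE v J) (hu' : OscLE u' J)
    (hv' : OscLE v' J) (hsum : ∑ i, ∑ j, Y i j = 1) (hXc : X ∈ couplings r c)
    (hr : ∑ i, r i = 1) :
    norm1 (fun i j => Y i j - X i j) ^ 2 ≤ J * marginalError r c Y := by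
  have hsumX := sum_eq_one_of_mem_couplings hXc hr
  have hYX : norm1 (fun i j => Y i j - X i j) ^ 2 ≤ _ := sq_norm1_sub_le_two_mul_relEntropy
    (uncurry_mem_stdSimplex (fun i j => (hY.pos hK i j).le) hsum)
    (uncurry_mem_stdSimplex hXc.1 hsumX) (hX.pos hK)
  have hXY : norm1 (fun i j => X i j - Y i j) ^ 2 ≤ _ := sq_norm1_sub_le_two_mul_relEntropy
    (uncurry_mem_stdSimplex hXc.1 hsumX)
    (uncurry_mem_stdSimplex (fun i j => (hY.pos hK i j).le) hsum) (hY.pos hK)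
  have hsymm : norm1 (fun i j => X i j - Y i j) = norm1 (fun i j => Y i j - X i j) := by
    simp only [norm1, abs_sub_comm]
  have hsymmetrised := relEntropy_add_relEntropy_of_isScaling hK hY hX
  simp_rw [hXc.2.1, hXc.2.2] at hsymmetrised
  have hrow := sum_mul_le_of_oscLE (J := J) (w := fun i => ∑ j, Y i j - r i)
    (by rw [Finset.sum_sub_distrib, hsum, hr, sub_self]) (by simpa only [two_mul] using hu.sub hu')
  have hcol := sum_mul_le_of_oscLE (J := J) (w := fun j => ∑ i, Y i j - c j)
    (by
      simp_rw [← hXc.2.2]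
      rw [Finset.sum_sub_distrib, Finset.sum_comm, hsum, Finset.sum_comm, hsumX, sub_self])
    (by simpa only [two_mul] using hv.sub hv')
  rw [hsymm] at hXY
  rw [marginalError, mul_add]
  linarith

theorem mul_objective_sub_objective (hξ : ξ ≠ 0)
    (hY : IsScaling (fun i j => exp (-(ξ * C i j))) u v Y) (hYc : Y ∈ couplings r c)
    (hXc : X ∈ couplings r c) :
    ξ * (objective C ξ X - objective C ξ Y) = relEntropy (uncurry X) (uncurry Y) := by
  have hmarginals : ∑ i, ∑ j, (X i j - Y i j) * (u i + v j) = 0 := by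
    simp [sum_sub_mul_add, hXc.2.1, hXc.2.2, hYc.2.1, hYc.2.2]
  have hcost : ∀ i j, ξ * C i j = u i + v j - log (Y i j) := fun i j => by
    rw [hY.log_apply (fun _ _ => exp_pos _), log_exp]
    ring
  have hexpand : ξ * (objective C ξ X - objective C ξ Y) =
      ∑ i, ∑ j, ((X i j - Y i j) * (ξ * C i j) + X i j * log (X i j) - Y i j * log (Y i j)) := by
    simp only [objective, entropy, mul_sub, sub_mul, mul_left_comm _ ξ, Finset.sum_sub_distrib,
      Finset.sum_add_distrib, ← Finset.mul_sum]
    field_simp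
    ring
  rw [hexpand, relEntropy_uncurry, ← sub_eq_zero, ← hmarginals, ← Finset.sum_sub_distrib]
  refine Finset.sum_congr rfl fun i _ => ?_
  rw [← Finset.sum_sub_distrib]
  refine Finset.sum_congr rfl fun j _ => ?_
  rw [hcost]
  ring

theorem isOptimal_iff_of_isScaling (hξ : 0 < ξ)
    (hY : IsScaling (fun i j => exp (-(ξ * C i j))) u v Y) (hYc : Y ∈ couplings r c)
    (hr : ∑ i, r i = 1) : IsOptimal r c C ξ X ↔ X = Y := by
  have hpinsker : ∀ Z ∈ couplings r c,
      norm1 (fun i j => Z i j - Y i j) ^ 2 ≤ 2 * (ξ * (objective C ξ Z - objective C ξ Y)) :=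
    fun Z hZ => by
      rw [mul_objective_sub_objective hξ.ne' hY hYc hZ]
      exact sq_norm1_sub_le_two_mul_relEntropy
        (uncurry_mem_stdSimplex hZ.1 (sum_eq_one_of_mem_couplings hZ hr))
        (uncurry_mem_stdSimplex hYc.1 (sum_eq_one_of_mem_couplings hYc hr))
        (hY.pos fun _ _ => exp_pos _)
  constructor
  · rintro ⟨hX, hmin⟩
    have hle : objective C ξ X ≤ objective C ξ Y := hmin hYc
    have hzero : norm1 (fun i j => X i j - Y i j) = 0 := by
      have : ξ * (objective C ξ X - objective C ξ Y) ≤ 0 :=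
        mul_nonpos_of_nonneg_of_nonpos hξ.le (sub_nonpos.2 hle)
      exact pow_eq_zero_iff two_ne_zero |>.1
        (le_antisymm (by linarith [hpinsker X hX]) (sq_nonneg _))
    funext i j
    have hrow := (Finset.sum_eq_zero_iff_of_nonneg fun i _ =>
      Finset.sum_nonneg fun j _ => abs_nonneg _).1 hzero i (Finset.mem_univ i)
    exact sub_eq_zero.1 (abs_eq_zero.1
      ((Finset.sum_eq_zero_iff_of_nonneg fun j _ => abs_nonneg _).1 hrow j (Finset.mem_univ j)))
  · rintro rfl
    refine ⟨hYc, fun Z hZ => ?_⟩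
    have hnonneg : 0 ≤ ξ * (objective C ξ Z - objective C ξ X) := by
      linarith [hpinsker Z hZ, sq_nonneg (norm1 fun i j => Z i j - X i j)]
    exact sub_nonneg.1 (nonneg_of_mul_nonneg_right hnonneg hξ)

end Stability

/-! ### Convergence of the alternating updates -/

section Input

variable {ι κ : Type*} [Fintype ι] [Fintype κ] {K X : ι → κ → ℝ} {u : ι → ℝ} {v : κ → ℝ}
  {r : ι → ℝ} {c : κ → ℝ} {M b : ℝ}

/-- Data for which the convergence of `Sinkhorn` is quantified: the positive matrix `K` has entries
with ratios at most `e^M`, and the marginals are probability vectors with entries at least `b`. -/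
structure IsSinkhornInput (K : ι → κ → ℝ) (r : ι → ℝ) (c : κ → ℝ) (M b : ℝ) : Prop where
  kernel_pos : ∀ i j, 0 < K i j
  kernel_le : ∀ i j i' j', K i j ≤ exp M * K i' j'
  row_mem : r ∈ stdSimplex ℝ ι
  col_mem : c ∈ stdSimplex ℝ κ
  floor_pos : 0 < b
  le_row : ∀ i, b ≤ r i
  le_col : ∀ j, b ≤ c j

theorem nonempty_of_mem_stdSimplex (hr : r ∈ stdSimplex ℝ ι) : Nonempty ι := by
  by_contra hempty
  rw [not_nonempty_iff] at hempty
  simpa using hr.2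

namespace IsSinkhornInput

theorem flip (h : IsSinkhornInput K r c M b) : IsSinkhornInput (flip K) c r M b where
  kernel_pos j i := h.kernel_pos i j
  kernel_le j i j' i' := h.kernel_le i j i' j'
  row_mem := h.col_mem
  col_mem := h.row_mem
  floor_pos := h.floor_pos
  le_row := h.le_col
  le_col := h.le_row

theorem nonempty_rows (h : IsSinkhornInput K r c M b) : Nonempty ι :=
  nonempty_of_mem_stdSimplex h.row_mem

theorem nonempty_cols (h : IsSinkhornInput K r c M b) : Nonempty κ :=
  nonempty_of_mem_stdSimplex h.col_mem

theorem row_pos (h : IsSinkhornInput K r c M b) (i : ι) : 0 < r i :=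
  h.floor_pos.trans_le (h.le_row i)

theorem col_pos (h : IsSinkhornInput K r c M b) (j : κ) : 0 < c j := h.flip.row_pos j

theorem row_le_one (h : IsSinkhornInput K r c M b) (i : ι) : r i ≤ 1 :=
  (Finset.single_le_sum (fun i _ => h.row_mem.1 i) (Finset.mem_univ i)).trans_eq h.row_mem.2

theorem exponent_nonneg (h : IsSinkhornInput K r c M b) : 0 ≤ M := by
  obtain ⟨i⟩ := h.nonempty_rows
  obtain ⟨j⟩ := h.nonempty_cols
  have hone : 1 * K i j ≤ exp M * K i j := (one_mul _).trans_le (h.kernel_le i j i j)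
  exact one_le_exp_iff.1 (le_of_mul_le_mul_right hone (h.kernel_pos i j))

theorem log_floor_nonpos (h : IsSinkhornInput K r c M b) : log b ≤ 0 := by
  obtain ⟨i⟩ := h.nonempty_rows
  exact log_nonpos h.floor_pos.le ((h.le_row i).trans (h.row_le_one i))

/-- Comparing the rows `i` and `i'` of `X` entry by entry bounds `e^(u i - u i') r i'` by
`e^M r i`. -/
theorem oscLE_left (h : IsSinkhornInput K r c M b) (hX : IsScaling K u v X)
    (hrow : ∀ i, ∑ j, X i j = r i) : OscLE u (M - log b) := fun i i' => by
  have hentry : ∀ j, exp (u i - u i') * X i' j ≤ exp M * X i j := fun j => by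
    calc exp (u i - u i') * X i' j = exp (u i) * K i' j * exp (v j) := by
          rw [hX i' j, exp_sub]
          field_simp
      _ ≤ exp (u i) * (exp M * K i j) * exp (v j) := by
          gcongr
          exact h.kernel_le i' j i j
      _ = exp M * X i j := by
          rw [hX i j]
          ring
  have hrows : exp (u i - u i') * r i' ≤ exp M * r i := by
    rw [← hrow i, ← hrow i', Finset.mul_sum, Finset.mul_sum]
    exact Finset.sum_le_sum fun j _ => hentry j
  have hexp : exp (u i - u i') * b ≤ exp M :=
    calc exp (u i - u i') * b ≤ exp (u i - u i') * r i' := by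
          gcongr
          exact h.le_row i'
      _ ≤ exp M * r i := hrows
      _ ≤ exp M := mul_le_of_le_one_right (exp_pos _).le (h.row_le_one i)
  rw [← exp_le_exp, exp_sub M, exp_log h.floor_pos]
  exact (le_div_iff₀ h.floor_pos).2 hexp

theorem oscLE_right (h : IsSinkhornInput K r c M b) (hX : IsScaling K u v X)
    (hcol : ∀ j, ∑ i, X i j = c j) : OscLE v (M - log b) :=
  h.flip.oscLE_left hX.flip hcol

end IsSinkhornInput

end Input

section HalfSteps

variable {ι κ : Type*} [Fintype κ] {K X : ι → κ → ℝ} {u : ι → ℝ} {v : κ → ℝ} {r : ι → ℝ}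

/-- The matrix obtained from `X` by rescaling the rows so that they have the sums `r`. -/
def rowUpdate (r : ι → ℝ) (X : ι → κ → ℝ) (i : ι) (j : κ) : ℝ := r i / (∑ j, X i j) * X i j

/-- The matrix obtained from `X` by rescaling the columns so that they have the sums `c`. -/
def colUpdate [Fintype ι] (c : κ → ℝ) (X : ι → κ → ℝ) : ι → κ → ℝ := flip (rowUpdate c (flip X))

theorem row_sum_pos [Nonempty κ] (hX : ∀ i j, 0 < X i j) (i : ι) : 0 < ∑ j, X i j :=
  Finset.sum_pos (fun j _ => hX i j) Finset.univ_nonempty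

theorem sum_rowUpdate {i : ι} (hX : ∑ j, X i j ≠ 0) : ∑ j, rowUpdate r X i j = r i := by
  simp_rw [rowUpdate, ← Finset.mul_sum]
  exact div_mul_cancel₀ _ hX

theorem rowUpdate_pos [Nonempty κ] (hr : ∀ i, 0 < r i) (hX : ∀ i j, 0 < X i j) (i : ι) (j : κ) :
    0 < rowUpdate r X i j :=
  mul_pos (div_pos (hr i) (row_sum_pos hX i)) (hX i j)

theorem rowUpdate_mul_rows {w : ι → ℝ} (hw : ∀ i, w i ≠ 0) :
    rowUpdate r (fun i j => w i * X i j) = rowUpdate r X := by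
  funext i j
  simp_rw [rowUpdate, ← Finset.mul_sum]
  rw [← mul_assoc, mul_comm (w i) (∑ j, X i j), ← div_div, div_mul_cancel₀ _ (hw i)]

theorem IsScaling.rowUpdate [Nonempty κ] (hX : IsScaling K u v X) (hr : ∀ i, 0 < r i)
    (hpos : ∀ i j, 0 < X i j) :
    IsScaling K (fun i => u i + log (r i / ∑ j, X i j)) v (rowUpdate r X) :=
  hX.mul_rows fun i => div_pos (hr i) (row_sum_pos hpos i)

end HalfSteps

section Progress

variable {ι κ : Type} [Fintype ι] [Fintype κ] {X : ι → κ → ℝ} {r : ι → ℝ} {c : κ → ℝ} {M : ℝ}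

/-- The relative entropy of `r ⊗ c` with respect to `X`, which decreases along `Sinkhorn`. -/
def productGap (r : ι → ℝ) (c : κ → ℝ) (X : ι → κ → ℝ) : ℝ :=
  relEntropy (uncurry fun i j => r i * c j) (uncurry X)

theorem productGap_eq (r : ι → ℝ) (c : κ → ℝ) (X : ι → κ → ℝ) :
    productGap r c X = ∑ i, ∑ j, r i * c j * (log (r i * c j) - log (X i j)) :=
  relEntropy_uncurry _ _

theorem productGap_flip : productGap c r (flip X) = productGap r c X := by
  simp only [productGap_eq, flip_def, mul_comm (c _)]
  exact Finset.sum_comm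

theorem uncurry_mul_mem_stdSimplex (hr : r ∈ stdSimplex ℝ ι) (hc : c ∈ stdSimplex ℝ κ) :
    uncurry (fun i j => r i * c j) ∈ stdSimplex ℝ (ι × κ) :=
  uncurry_mem_stdSimplex (fun i j => mul_nonneg (hr.1 i) (hc.1 j)) (by
    simp_rw [← Finset.mul_sum, hc.2, mul_one, hr.2])

theorem productGap_nonneg (hr : r ∈ stdSimplex ℝ ι) (hc : c ∈ stdSimplex ℝ κ)
    (hX : ∀ i j, 0 < X i j) (hsum : ∑ i, ∑ j, X i j = 1) : 0 ≤ productGap r c X :=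
  relEntropy_nonneg (uncurry_mul_mem_stdSimplex hr hc)
    (uncurry_mem_stdSimplex (fun i j => (hX i j).le) hsum) fun z => hX z.1 z.2

theorem productGap_le (hr : r ∈ stdSimplex ℝ ι) (hc : c ∈ stdSimplex ℝ κ)
    (hr0 : ∀ i, 0 < r i) (hc0 : ∀ j, 0 < c j) (hX : ∀ i j, 0 < X i j)
    (hle : ∀ i j, r i * c j ≤ exp M * X i j) : productGap r c X ≤ M := by
  have hlog : ∀ i j, log (r i * c j) - log (X i j) ≤ M := fun i j => by
    rw [← log_div (mul_pos (hr0 i) (hc0 j)).ne' (hX i j).ne',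
      log_le_iff_le_exp (div_pos (mul_pos (hr0 i) (hc0 j)) (hX i j)), div_le_iff₀ (hX i j)]
    exact hle i j
  calc productGap r c X ≤ ∑ i, ∑ j, r i * c j * M := by
        rw [productGap_eq]
        gcongr with i _ j _
        · exact mul_nonneg (hr0 i).le (hc0 j).le
        · exact hlog i j
    _ = M := by simp_rw [← Finset.sum_mul, ← Finset.mul_sum, hc.2, mul_one, hr.2, one_mul]

theorem productGap_sub_productGap_rowUpdate [Nonempty κ] (hc : ∑ j, c j = 1) (hr0 : ∀ i, 0 < r i)
    (hX : ∀ i j, 0 < X i j) :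
    productGap r c X - productGap r c (rowUpdate r X) = relEntropy r fun i => ∑ j, X i j := by
  have hlog : ∀ i j, log (rowUpdate r X i j) = log (r i) - log (∑ j, X i j) + log (X i j) :=
    fun i j => by
      have hrow := row_sum_pos hX i
      rw [rowUpdate, log_mul (div_pos (hr0 i) hrow).ne' (hX i j).ne',
        log_div (hr0 i).ne' hrow.ne']
  have hterm : ∀ i j, r i * c j * (log (r i * c j) - log (X i j)) -
      r i * c j * (log (r i * c j) - log (rowUpdate r X i j)) =
        r i * (log (r i) - log (∑ j, X i j)) * c j := fun i j => by
    rw [hlog]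
    ring
  simp_rw [productGap_eq, ← Finset.sum_sub_distrib, hterm, ← Finset.mul_sum, hc, mul_one]
  rfl

/-- By Pinsker's inequality for the row sums. -/
theorem sq_marginalError_le_of_col_sums [Nonempty κ] (hr : r ∈ stdSimplex ℝ ι)
    (hc : ∑ j, c j = 1) (hr0 : ∀ i, 0 < r i) (hX : ∀ i j, 0 < X i j)
    (hcol : ∀ j, ∑ i, X i j = c j) :
    marginalError r c X ^ 2 ≤ 2 * (productGap r c X - productGap r c (rowUpdate r X)) := by
  have hrows : (fun i => ∑ j, X i j) ∈ stdSimplex ℝ ι :=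
    ⟨fun i => (row_sum_pos hX i).le, by rw [Finset.sum_comm]; simp_rw [hcol, hc]⟩
  have herror : marginalError r c X = ∑ i, |r i - ∑ j, X i j| := by
    simp [marginalError, hcol, abs_sub_comm]
  rw [herror, productGap_sub_productGap_rowUpdate hc hr0 hX]
  exact sq_sum_abs_sub_le_two_mul_relEntropy hr hrows (row_sum_pos hX)

end Progress

section Iterates

variable {ι κ : Type} [Fintype ι] [Fintype κ] {K : ι → κ → ℝ} {r : ι → ℝ} {c : κ → ℝ} {M b : ℝ}

/-- The matrix `X_{n+2}` of `Sinkhorn`. The numbering starts at `2` because `X_0` and `X_1` need not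
have total mass one. -/
def sinkhornIterate (K : ι → κ → ℝ) (r : ι → ℝ) (c : κ → ℝ) : ℕ → ι → κ → ℝ
  | 0 => colUpdate c (rowUpdate r K)
  | n + 1 =>
    if Even n then rowUpdate r (sinkhornIterate K r c n) else colUpdate c (sinkhornIterate K r c n)

namespace IsSinkhornInput

theorem rowUpdate_pos (h : IsSinkhornInput K r c M b) {X : ι → κ → ℝ} (hX : ∀ i j, 0 < X i j) :
    ∀ i j, 0 < rowUpdate r X i j :=
  have := h.nonempty_cols
  EntropicOT.rowUpdate_pos h.row_pos hX

theorem colUpdate_pos (h : IsSinkhornInput K r c M b) {X : ι → κ → ℝ} (hX : ∀ i j, 0 < X i j)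
    (i : ι) (j : κ) : 0 < colUpdate c X i j :=
  h.flip.rowUpdate_pos (fun j i => hX i j) j i

theorem sum_rowUpdate (h : IsSinkhornInput K r c M b) {X : ι → κ → ℝ} (hX : ∀ i j, 0 < X i j)
    (i : ι) : ∑ j, rowUpdate r X i j = r i :=
  have := h.nonempty_cols
  EntropicOT.sum_rowUpdate (row_sum_pos hX i).ne'

theorem sum_colUpdate (h : IsSinkhornInput K r c M b) {X : ι → κ → ℝ} (hX : ∀ i j, 0 < X i j)
    (j : κ) : ∑ i, colUpdate c X i j = c j :=
  h.flip.sum_rowUpdate (fun j i => hX i j) j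

theorem sinkhornIterate_pos (h : IsSinkhornInput K r c M b) (n : ℕ) :
    ∀ i j, 0 < sinkhornIterate K r c n i j := by
  induction n with
  | zero => exact h.colUpdate_pos (h.rowUpdate_pos h.kernel_pos)
  | succ n ih =>
    rw [sinkhornIterate]
    split_ifs
    exacts [h.rowUpdate_pos ih, h.colUpdate_pos ih]

theorem col_sum_sinkhornIterate (h : IsSinkhornInput K r c M b) {n : ℕ} (hn : Even n) (j : κ) :
    ∑ i, sinkhornIterate K r c n i j = c j := by
  cases n with
  | zero => exact h.sum_colUpdate (h.rowUpdate_pos h.kernel_pos) j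
  | succ n =>
    rw [sinkhornIterate, if_neg (Nat.even_add_one.1 hn)]
    exact h.sum_colUpdate (h.sinkhornIterate_pos n) j

theorem row_sum_sinkhornIterate (h : IsSinkhornInput K r c M b) {n : ℕ} (hn : ¬ Even n) (i : ι) :
    ∑ j, sinkhornIterate K r c n i j = r i := by
  cases n with
  | zero => exact absurd Even.zero hn
  | succ n =>
    rw [sinkhornIterate, if_pos (not_not.1 fun h => hn (Nat.even_add_one.2 h))]
    exact h.sum_rowUpdate (h.sinkhornIterate_pos n) i

theorem sum_sinkhornIterate (h : IsSinkhornInput K r c M b) (n : ℕ) :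
    ∑ i, ∑ j, sinkhornIterate K r c n i j = 1 := by
  by_cases hn : Even n
  · rw [Finset.sum_comm]
    simp_rw [h.col_sum_sinkhornIterate hn, h.col_mem.2]
  · simp_rw [h.row_sum_sinkhornIterate hn, h.row_mem.2]

theorem mul_rowUpdate_kernel_le (h : IsSinkhornInput K r c M b) (i i' : ι) (j : κ) :
    r i * rowUpdate r K i' j ≤ exp (2 * M) * rowUpdate r K i j * r i' := by
  have := h.nonempty_cols
  have hi := row_sum_pos h.kernel_pos i
  have hi' := row_sum_pos h.kernel_pos i'
  have hrows : ∑ j, K i j ≤ exp M * ∑ j, K i' j := by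
    rw [Finset.mul_sum]
    exact Finset.sum_le_sum fun j _ => h.kernel_le i j i' j
  have hcross : (∑ j, K i j) * K i' j ≤ exp M * (∑ j, K i' j) * (exp M * K i j) :=
    mul_le_mul hrows (h.kernel_le i' j i j) (h.kernel_pos i' j).le (by positivity)
  have hfactor : 0 ≤ r i * r i' / ((∑ j, K i j) * ∑ j, K i' j) :=
    div_nonneg (mul_nonneg (h.row_pos i).le (h.row_pos i').le) (mul_nonneg hi.le hi'.le)
  calc r i * rowUpdate r K i' j
      = r i * r i' / ((∑ j, K i j) * ∑ j, K i' j) * ((∑ j, K i j) * K i' j) := by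
        unfold rowUpdate
        field_simp
    _ ≤ r i * r i' / ((∑ j, K i j) * ∑ j, K i' j) * (exp M * (∑ j, K i' j) * (exp M * K i j)) :=
        mul_le_mul_of_nonneg_left hcross hfactor
    _ = exp (2 * M) * rowUpdate r K i j * r i' := by
        rw [rowUpdate, two_mul, exp_add]
        field_simp

theorem productGap_sinkhornIterate_zero_le (h : IsSinkhornInput K r c M b) :
    productGap r c (sinkhornIterate K r c 0) ≤ 2 * M := by
  refine productGap_le h.row_mem h.col_mem h.row_pos h.col_pos (h.sinkhornIterate_pos 0)
    fun i j => ?_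
  have := h.nonempty_rows
  have hpos : 0 < ∑ i, rowUpdate r K i j :=
    row_sum_pos (fun j i => h.rowUpdate_pos h.kernel_pos i j) j
  have hcol : r i * ∑ i', rowUpdate r K i' j ≤ exp (2 * M) * rowUpdate r K i j := by
    rw [Finset.mul_sum, ← mul_one (exp _ * _), ← h.row_mem.2, Finset.mul_sum]
    exact Finset.sum_le_sum fun i' _ => h.mul_rowUpdate_kernel_le i i' j
  calc r i * c j = c j / (∑ i', rowUpdate r K i' j) * (r i * ∑ i', rowUpdate r K i' j) := by
        field_simp
    _ ≤ c j / (∑ i', rowUpdate r K i' j) * (exp (2 * M) * rowUpdate r K i j) :=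
        mul_le_mul_of_nonneg_left hcol (div_pos (h.col_pos j) hpos).le
    _ = exp (2 * M) * sinkhornIterate K r c 0 i j := mul_left_comm _ _ _

theorem sq_marginalError_sinkhornIterate_le (h : IsSinkhornInput K r c M b) (n : ℕ) :
    marginalError r c (sinkhornIterate K r c n) ^ 2 ≤
      2 * (productGap r c (sinkhornIterate K r c n) -
        productGap r c (sinkhornIterate K r c (n + 1))) := by
  have := h.nonempty_rows
  have := h.nonempty_cols
  have hpos := h.sinkhornIterate_pos n
  rw [sinkhornIterate]
  split_ifs with hn
  · exact sq_marginalError_le_of_col_sums h.row_mem h.col_mem.2 h.row_pos hpos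
      (h.col_sum_sinkhornIterate hn)
  · rw [← marginalError_flip, ← productGap_flip (X := sinkhornIterate K r c n),
      ← productGap_flip (X := colUpdate c _)]
    exact sq_marginalError_le_of_col_sums h.col_mem h.row_mem.2 h.col_pos (fun j i => hpos i j)
      (h.row_sum_sinkhornIterate hn)

theorem sum_sq_marginalError_sinkhornIterate_le (h : IsSinkhornInput K r c M b) (n : ℕ) :
    ∑ k ∈ Finset.range n, marginalError r c (sinkhornIterate K r c k) ^ 2 ≤ 4 * M := by
  have hlast := productGap_nonneg h.row_mem h.col_mem (h.sinkhornIterate_pos n)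
    (h.sum_sinkhornIterate n)
  calc ∑ k ∈ Finset.range n, marginalError r c (sinkhornIterate K r c k) ^ 2
      ≤ ∑ k ∈ Finset.range n, 2 * (productGap r c (sinkhornIterate K r c k) -
          productGap r c (sinkhornIterate K r c (k + 1))) :=
        Finset.sum_le_sum fun k _ => h.sq_marginalError_sinkhornIterate_le k
    _ = 2 * (productGap r c (sinkhornIterate K r c 0) -
          productGap r c (sinkhornIterate K r c n)) := by
        rw [← Finset.mul_sum, Finset.sum_range_sub']
    _ ≤ 4 * M := by linarith [h.productGap_sinkhornIterate_zero_le]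

end IsSinkhornInput

end Iterates

/-! ### The states of `Sinkhorn` -/

namespace Timed

theorem pure_cost {α : Type} (a : α) : (pure a : Timed α).cost = 0 := rfl

theorem bind_val {α β : Type} (x : Timed α) (f : α → Timed β) :
    (x >>= f).val = (f x.val).val := rfl

theorem bind_cost {α β : Type} (x : Timed α) (f : α → Timed β) :
    (x >>= f).cost = x.cost + (f x.val).cost := rfl

theorem exists_whileRuns {σ : Type} {test : σ → Timed Bool} {body : σ → Timed σ} {B : ℕ}
    (hB : ∀ s, (test s).cost + (body s).cost ≤ B) (k : ℕ) (s : σ)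
    (htrue : ∀ i < k, (test ((fun s => (body s).val)^[i] s)).val = true)
    (hfalse : (test ((fun s => (body s).val)^[k] s)).val = false) :
    ∃ t, WhileRuns test body s ((fun s => (body s).val)^[k] s) t ∧ t ≤ (k + 1) * B := by
  induction k generalizing s with
  | zero => exact ⟨_, .finished s hfalse, by linarith [hB s]⟩
  | succ k ih =>
    obtain ⟨t, hrun, ht⟩ := ih (body s).val (fun i hi => htrue (i + 1) (by omega)) hfalse
    exact ⟨_, .step s _ t (htrue 0 (by omega)) hrun, by linarith [hB s]⟩

end Timed

theorem isScaling_add_zero_iff {ι κ : Type} {K X : ι → κ → ℝ} {u : ι → ℝ} {v : κ → ℝ} :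
    IsScaling K (fun i => u i + 0) v X ↔ IsScaling K u v X := by
  simp only [add_zero]

theorem IsScaling.eq_exp_neg_mul {ι κ : Type} {K X : ι → κ → ℝ} {u : ι → ℝ} {v : κ → ℝ} {a : ℝ}
    (hX : IsScaling K (fun i => u i + a) v X) :
    (fun i j => exp (u i) * K i j * exp (v j)) = fun i j => exp (-a) * X i j := by
  funext i j
  rw [hX i j, exp_add, exp_neg]
  field_simp

theorem colUpdate_const_mul {ι κ : Type} [Fintype ι] {X : ι → κ → ℝ} {c : κ → ℝ} {t : ℝ}
    (ht : t ≠ 0) : colUpdate c (fun i j => t * X i j) = colUpdate c X :=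
  congrArg flip (rowUpdate_mul_rows (X := flip X) (w := fun _ => t) fun _ => ht)

section States

variable {ι κ : Type} [Fintype ι] [Fintype κ] {K X : ι → κ → ℝ} {u : ι → ℝ} {v : κ → ℝ}
  {r : ι → ℝ} {c : κ → ℝ} {M b J a : ℝ} {s : SinkhornState ι κ}

theorem sinkhornInit_val (hK : ∀ i j, 0 ≤ K i j) :
    (sinkhornInit K).val = ⟨0, normalize K, fun _ => 0, fun _ => 0⟩ := by
  have hval : (sinkhornInit K).val =
      ⟨0, fun i j => K i j / ∑ i, ∑ j, |K i j|, fun _ => 0, fun _ => 0⟩ := rfl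
  simp only [hval, abs_of_nonneg (hK _ _)]
  rfl

theorem sinkhornBody_val_of_even (K : ι → κ → ℝ) (r : ι → ℝ) (c : κ → ℝ) (hs : Even s.k) :
    (sinkhornBody K r c s).val = ⟨s.k + 1,
      fun i j => exp (s.u i + log (r i / ∑ j, s.X i j)) * K i j * exp (s.v j),
      fun i => s.u i + log (r i / ∑ j, s.X i j), s.v⟩ := by
  have hodd : (s.k + 1) % 2 = 1 := Nat.odd_iff.1 hs.add_one
  simp only [sinkhornBody, Timed.bind_val, Timed.natSucc, Timed.natOdd, hodd, decide_true, if_true]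
  rfl

theorem sinkhornBody_val_of_odd (K : ι → κ → ℝ) (r : ι → ℝ) (c : κ → ℝ) (hs : ¬ Even s.k) :
    (sinkhornBody K r c s).val = ⟨s.k + 1,
      fun i j => exp (s.u i) * K i j * exp (s.v j + log (c j / ∑ i, s.X i j)),
      s.u, fun j => s.v j + log (c j / ∑ i, s.X i j)⟩ := by
  have heven : ¬ (s.k + 1) % 2 = 1 := by
    rw [Nat.not_even_iff] at hs
    omega
  simp only [sinkhornBody, Timed.bind_val, Timed.natSucc, Timed.natOdd, heven, decide_false,
    Bool.false_eq_true, if_false]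
  rfl

theorem sinkhornBody_val_k (K : ι → κ → ℝ) (r : ι → ℝ) (c : κ → ℝ) (s : SinkhornState ι κ) :
    (sinkhornBody K r c s).val.k = s.k + 1 := by
  by_cases hs : Even s.k
  · rw [sinkhornBody_val_of_even K r c hs]
  · rw [sinkhornBody_val_of_odd K r c hs]

theorem isScaling_sinkhornBody (K : ι → κ → ℝ) (r : ι → ℝ) (c : κ → ℝ) (s : SinkhornState ι κ) :
    IsScaling K (sinkhornBody K r c s).val.u (sinkhornBody K r c s).val.v
      (sinkhornBody K r c s).val.X := by
  by_cases hs : Even s.k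
  · rw [sinkhornBody_val_of_even K r c hs]
    exact fun _ _ => rfl
  · rw [sinkhornBody_val_of_odd K r c hs]
    exact fun _ _ => rfl

/-- The invariant of the loop in `Sinkhorn`. The shift `a` accounts for the division by `‖K‖₁` in
the initial state. -/
structure SinkhornInvariant (K : ι → κ → ℝ) (J : ℝ) (s : SinkhornState ι κ) : Prop where
  isScaling : ∃ a, IsScaling K (fun i => s.u i + a) s.v s.X
  oscLE_left : OscLE s.u J
  oscLE_right : OscLE s.v J

theorem IsScaling.normalize (hX : IsScaling K u v X) (hsum : 0 < ∑ i, ∑ j, X i j) :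
    IsScaling K (fun i => u i + log (∑ i, ∑ j, X i j)⁻¹) v (normalize X) := fun i j => by
  rw [EntropicOT.normalize, div_eq_inv_mul]
  exact hX.mul_rows (fun _ => inv_pos.2 hsum) i j

theorem sum_sum_pos [Nonempty ι] [Nonempty κ] (hX : ∀ i j, 0 < X i j) : 0 < ∑ i, ∑ j, X i j :=
  Finset.sum_pos (fun i _ => row_sum_pos hX i) Finset.univ_nonempty

namespace IsSinkhornInput

theorem log_bound_nonneg (h : IsSinkhornInput K r c M b) : 0 ≤ M - log b := by
  linarith [h.exponent_nonneg, h.log_floor_nonpos]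

theorem invariant_sinkhornInit (h : IsSinkhornInput K r c M b) :
    SinkhornInvariant K (M - log b) (sinkhornInit K).val := by
  have := h.nonempty_rows
  have := h.nonempty_cols
  have hJ := h.log_bound_nonneg
  have hself : IsScaling K (fun _ => 0) (fun _ => 0) K := fun i j => by simp
  rw [sinkhornInit_val fun i j => (h.kernel_pos i j).le]
  exact ⟨⟨_, hself.normalize (sum_sum_pos h.kernel_pos)⟩, fun _ _ => (sub_self _).trans_le hJ,
    fun _ _ => (sub_self _).trans_le hJ⟩

theorem oscLE_log_add (h : IsSinkhornInput K r c M b)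
    (hX : IsScaling K (fun i => u i + a) v X) :
    OscLE (fun i => u i + log (r i / ∑ j, X i j)) (M - log b) := by
  have := h.nonempty_cols
  have hpos := hX.pos h.kernel_pos
  have hosc := (h.oscLE_left (hX.rowUpdate h.row_pos hpos) (h.sum_rowUpdate hpos)).add_const (-a)
  simpa only [add_right_comm, add_neg_cancel_right] using hosc

theorem invariant_sinkhornBody (h : IsSinkhornInput K r c M b)
    (hs : SinkhornInvariant K (M - log b) s) :
    SinkhornInvariant K (M - log b) (sinkhornBody K r c s).val := by
  have hscaling := isScaling_sinkhornBody K r c s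
  obtain ⟨a, ha⟩ := hs.isScaling
  refine ⟨⟨0, isScaling_add_zero_iff.2 hscaling⟩, ?_, ?_⟩ <;> by_cases hk : Even s.k
  · rw [sinkhornBody_val_of_even K r c hk]
    exact h.oscLE_log_add ha
  · rw [sinkhornBody_val_of_odd K r c hk]
    exact hs.oscLE_left
  · rw [sinkhornBody_val_of_even K r c hk]
    exact hs.oscLE_right
  · rw [sinkhornBody_val_of_odd K r c hk]
    exact h.flip.oscLE_log_add (isScaling_add_zero_iff.2 ha.flip)

theorem sinkhornBody_X_of_even (h : IsSinkhornInput K r c M b) (hs : Even s.k)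
    (ha : IsScaling K (fun i => s.u i + a) s.v s.X) :
    (sinkhornBody K r c s).val.X = fun i j => exp (-a) * rowUpdate r s.X i j := by
  have := h.nonempty_cols
  rw [sinkhornBody_val_of_even K r c hs]
  refine IsScaling.eq_exp_neg_mul ?_
  simpa only [add_right_comm] using ha.rowUpdate h.row_pos (ha.pos h.kernel_pos)

theorem sinkhornBody_X_of_odd (h : IsSinkhornInput K r c M b) (hs : ¬ Even s.k)
    (hX : IsScaling K s.u s.v s.X) :
    (sinkhornBody K r c s).val.X = colUpdate c s.X := by
  have := h.nonempty_rows
  rw [sinkhornBody_val_of_odd K r c hs]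
  funext i j
  exact ((hX.flip.rowUpdate h.col_pos fun j i => hX.pos h.kernel_pos i j).flip i j).symm

end IsSinkhornInput

/-- The state of `Sinkhorn` after `k` passes through the loop. -/
def sinkhornState (K : ι → κ → ℝ) (r : ι → ℝ) (c : κ → ℝ) (k : ℕ) : SinkhornState ι κ :=
  (fun s => (sinkhornBody K r c s).val)^[k] (sinkhornInit K).val

theorem sinkhornState_succ (K : ι → κ → ℝ) (r : ι → ℝ) (c : κ → ℝ) (k : ℕ) :
    sinkhornState K r c (k + 1) = (sinkhornBody K r c (sinkhornState K r c k)).val :=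
  iterate_succ_apply' _ _ _

theorem sinkhornState_k (K : ι → κ → ℝ) (r : ι → ℝ) (c : κ → ℝ) (k : ℕ) :
    (sinkhornState K r c k).k = k := by
  induction k with
  | zero => rfl
  | succ k ih => rw [sinkhornState_succ, sinkhornBody_val_k, ih]

theorem isScaling_sinkhornState_succ (K : ι → κ → ℝ) (r : ι → ℝ) (c : κ → ℝ) (k : ℕ) :
    IsScaling K (sinkhornState K r c (k + 1)).u (sinkhornState K r c (k + 1)).v
      (sinkhornState K r c (k + 1)).X := by
  rw [sinkhornState_succ]
  exact isScaling_sinkhornBody K r c _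

theorem rowUpdate_normalize (hX : ∑ i, ∑ j, X i j ≠ 0) :
    rowUpdate r (normalize X) = rowUpdate r X := by
  have heq : normalize X = fun i j => (∑ i, ∑ j, X i j)⁻¹ * X i j := by
    funext i j
    exact div_eq_inv_mul _ _
  rw [heq, rowUpdate_mul_rows fun _ => inv_ne_zero hX]

namespace IsSinkhornInput

theorem invariant_sinkhornState (h : IsSinkhornInput K r c M b) (k : ℕ) :
    SinkhornInvariant K (M - log b) (sinkhornState K r c k) := by
  induction k with
  | zero => exact h.invariant_sinkhornInit
  | succ k ih =>
    rw [sinkhornState_succ]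
    exact h.invariant_sinkhornBody ih

theorem sinkhornState_pos (h : IsSinkhornInput K r c M b) (k : ℕ) (i : ι) (j : κ) :
    0 < (sinkhornState K r c k).X i j :=
  have ⟨_, ha⟩ := (h.invariant_sinkhornState k).isScaling
  ha.pos h.kernel_pos i j

theorem sinkhornState_one_X (h : IsSinkhornInput K r c M b) :
    ∃ t ≠ 0, (sinkhornState K r c 1).X = fun i j => t * rowUpdate r K i j := by
  have := h.nonempty_rows
  have := h.nonempty_cols
  obtain ⟨a, ha⟩ := h.invariant_sinkhornInit.isScaling
  refine ⟨exp (-a), (exp_pos _).ne', ?_⟩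
  rw [← rowUpdate_normalize (sum_sum_pos h.kernel_pos).ne', sinkhornState_succ]
  have hX : (sinkhornState K r c 0).X = normalize K :=
    congrArg SinkhornState.X (sinkhornInit_val fun i j => (h.kernel_pos i j).le)
  rw [← hX]
  exact h.sinkhornBody_X_of_even Even.zero ha

theorem sinkhornState_X (h : IsSinkhornInput K r c M b) (n : ℕ) :
    (sinkhornState K r c (n + 2)).X = sinkhornIterate K r c n := by
  induction n with
  | zero =>
    obtain ⟨t, ht, hX⟩ := h.sinkhornState_one_X
    rw [sinkhornState_succ, h.sinkhornBody_X_of_odd (by simp [sinkhornState_k])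
      (isScaling_sinkhornState_succ K r c 0), hX, colUpdate_const_mul ht]
    rfl
  | succ n ih =>
    have hscaling := isScaling_sinkhornState_succ K r c (n + 1)
    have hparity : Even (sinkhornState K r c (n + 2)).k ↔ Even n := by
      simp [sinkhornState_k, Nat.even_add]
    rw [sinkhornState_succ, sinkhornIterate, ← ih]
    split_ifs with hn
    · simp only [h.sinkhornBody_X_of_even (hparity.2 hn) (isScaling_add_zero_iff.2 hscaling),
        neg_zero, exp_zero, one_mul]
    · exact h.sinkhornBody_X_of_odd (hparity.not.2 hn) hscaling

theorem le_of_lt_marginalError (h : IsSinkhornInput K r c M b) {δ : ℝ} (hδ : 0 ≤ δ)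
    (hM : δ = 0 → M = 0) {k : ℕ}
    (herror : ∀ i < k, δ < marginalError r c (sinkhornState K r c i).X) :
    (k : ℝ) ≤ 2 + 4 * M / δ ^ 2 := by
  have hM0 := h.exponent_nonneg
  obtain hk | ⟨n, hn, rfl⟩ : k ≤ 2 ∨ ∃ n, 0 < n ∧ n + 2 = k := by
    obtain hk | hk := le_or_gt k 2
    exacts [.inl hk, .inr ⟨k - 2, by omega, by omega⟩]
  · have hk' : (k : ℝ) ≤ 2 := by exact_mod_cast hk
    have : 0 ≤ 4 * M / δ ^ 2 := by positivity
    linarith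
  have hsum : n * δ ^ 2 < 4 * M := by
    calc n * δ ^ 2 = ∑ i ∈ Finset.range n, δ ^ 2 := by simp
      _ < ∑ i ∈ Finset.range n, marginalError r c (sinkhornIterate K r c i) ^ 2 := by
          refine Finset.sum_lt_sum_of_nonempty (Finset.nonempty_range_iff.2 hn.ne') fun i hi => ?_
          rw [← h.sinkhornState_X]
          have := Finset.mem_range.1 hi
          exact pow_lt_pow_left₀ (herror _ (by omega)) hδ two_ne_zero
      _ ≤ 4 * M := h.sum_sq_marginalError_sinkhornIterate_le n
  have hδ' : δ ≠ 0 := fun h0 => by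
    rw [h0, hM h0] at hsum
    simp at hsum
  have hle : (n : ℝ) ≤ 4 * M / δ ^ 2 := (le_div_iff₀ (by positivity)).2 hsum.le
  push_cast
  linarith

theorem exists_forall_lt_and_marginalError_le (h : IsSinkhornInput K r c M b) {δ : ℝ}
    (hδ : 0 ≤ δ) (hM : δ = 0 → M = 0) :
    ∃ k : ℕ, (∀ i < k, δ < marginalError r c (sinkhornState K r c i).X) ∧
      marginalError r c (sinkhornState K r c k).X ≤ δ ∧ (k : ℝ) ≤ 2 + 4 * M / δ ^ 2 := by
  have hexists : ∃ k, marginalError r c (sinkhornState K r c k).X ≤ δ := by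
    by_contra! hall
    obtain ⟨k, hk⟩ := exists_nat_gt (2 + 4 * M / δ ^ 2)
    exact hk.not_ge (h.le_of_lt_marginalError hδ hM fun i _ => hall i)
  classical
  have hlt : ∀ i < Nat.find hexists, δ < marginalError r c (sinkhornState K r c i).X :=
    fun i hi => not_le.1 (Nat.find_min hexists hi)
  exact ⟨_, hlt, Nat.find_spec hexists, h.le_of_lt_marginalError hδ hM hlt⟩

end IsSinkhornInput

end States

/-! ### Existence of a scaling with prescribed marginals -/

section Existence

variable {ι κ : Type} [Fintype ι] [Fintype κ] {K X : ι → κ → ℝ} {u : ι → ℝ} {v : κ → ℝ}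
  {r : ι → ℝ} {c : κ → ℝ} {M b J : ℝ}

/-- The matrix `diag(e^u) K diag(e^v) / ‖diag(e^u) K diag(e^v)‖₁` as a function of `(u, v)`. -/
def gibbs (K : ι → κ → ℝ) (p : (ι → ℝ) × (κ → ℝ)) : ι → κ → ℝ :=
  normalize fun i j => exp (p.1 i) * K i j * exp (p.2 j)

theorem exists_mem_Icc_gibbs_eq_normalize [Nonempty ι] [Nonempty κ] (hX : IsScaling K u v X)
    (hu : OscLE u J) (hv : OscLE v J) :
    ∃ p ∈ Set.Icc (fun _ : ι => -J, fun _ : κ => -J) (fun _ => J, fun _ => J),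
      gibbs K p = normalize X := by
  obtain ⟨i₀⟩ := ‹Nonempty ι›
  obtain ⟨j₀⟩ := ‹Nonempty κ›
  refine ⟨(fun i => u i - u i₀, fun j => v j - v j₀),
    ⟨⟨fun i => neg_le_sub_iff_le_add.2 (by linarith [hu i₀ i]),
      fun j => neg_le_sub_iff_le_add.2 (by linarith [hv j₀ j])⟩,
      fun i => hu i i₀, fun j => hv j j₀⟩, ?_⟩
  rw [gibbs, ← normalize_const_mul (X := X) (exp_pos (-u i₀ - v j₀)).ne']
  congr! 3 with i j
  rw [hX i j, exp_sub, exp_sub, exp_sub, exp_neg]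
  field_simp

theorem gibbs_denom_pos [Nonempty ι] [Nonempty κ] (hK : ∀ i j, 0 < K i j)
    (p : (ι → ℝ) × (κ → ℝ)) : 0 < ∑ i, ∑ j, exp (p.1 i) * K i j * exp (p.2 j) :=
  sum_sum_pos fun i j => mul_pos (mul_pos (exp_pos _) (hK i j)) (exp_pos _)

theorem continuous_marginalError_gibbs [Nonempty ι] [Nonempty κ] (hK : ∀ i j, 0 < K i j) :
    Continuous fun p => marginalError r c (gibbs K p) := by
  unfold marginalError gibbs normalize
  fun_prop (disch := exact fun p => (gibbs_denom_pos hK p).ne')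

theorem IsSinkhornInput.exists_gibbs_marginalError_le (h : IsSinkhornInput K r c M b) {δ : ℝ}
    (hδ : 0 < δ) :
    ∃ p ∈ Set.Icc (fun _ : ι => -(M - log b), fun _ : κ => -(M - log b))
      (fun _ => M - log b, fun _ => M - log b), marginalError r c (gibbs K p) ≤ δ := by
  have := h.nonempty_rows
  have := h.nonempty_cols
  obtain ⟨k, -, herror, -⟩ := h.exists_forall_lt_and_marginalError_le (half_pos hδ).le
    fun h0 => absurd h0 (half_pos hδ).ne'
  have hinv := h.invariant_sinkhornState k
  have hpos := h.sinkhornState_pos k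
  obtain ⟨a, ha⟩ := hinv.isScaling
  obtain ⟨p, hp, heq⟩ := exists_mem_Icc_gibbs_eq_normalize ha (hinv.oscLE_left.add_const a)
    hinv.oscLE_right
  refine ⟨p, hp, ?_⟩
  rw [heq]
  linarith [marginalError_normalize_le (fun i j => (hpos i j).le) (sum_sum_pos hpos)
    h.row_mem.2 h.col_mem.2]

/-- The approximate solutions computed by `Sinkhorn` have potentials in a fixed compact set, on
which the marginal error attains its infimum. -/
theorem IsSinkhornInput.exists_isScaling_mem_couplings (h : IsSinkhornInput K r c M b) :
    ∃ X u v, IsScaling K u v X ∧ X ∈ couplings r c := by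
  have := h.nonempty_rows
  have := h.nonempty_cols
  obtain ⟨p₁, hp₁, -⟩ := h.exists_gibbs_marginalError_le one_pos
  obtain ⟨p, -, hmin⟩ := isCompact_Icc.exists_isMinOn ⟨p₁, hp₁⟩
    (continuous_marginalError_gibbs (r := r) (c := c) h.kernel_pos).continuousOn
  have hzero : marginalError r c (gibbs K p) = 0 := by
    refine le_antisymm (le_of_forall_pos_le_add fun δ hδ => ?_) marginalError_nonneg
    obtain ⟨q, hq, hle⟩ := h.exists_gibbs_marginalError_le hδ
    rw [zero_add]
    exact (hmin hq).trans hle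
  have hscaling : IsScaling K _ p.2 (gibbs K p) :=
    IsScaling.normalize (fun _ _ => rfl) (gibbs_denom_pos h.kernel_pos p)
  exact ⟨_, _, _, hscaling, mem_couplings_iff_marginalError_eq_zero.2
    ⟨fun i j => (hscaling.pos h.kernel_pos i j).le, hzero⟩⟩

end Existence

/-! ### The running time of `Sinkhorn` -/

section RunningTime

variable {ι κ : Type} [Fintype ι] [Fintype κ] {K : ι → κ → ℝ} {r : ι → ℝ} {c : κ → ℝ} {M b : ℝ}

theorem sinkhornInit_cost_le [Nonempty ι] [Nonempty κ] (K : ι → κ → ℝ) :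
    (sinkhornInit K).cost ≤ 9 * (Fintype.card ι * Fintype.card κ) := by
  have hι : 1 ≤ Fintype.card ι := Fintype.card_pos
  have hκ : 1 ≤ Fintype.card κ := Fintype.card_pos
  simp only [sinkhornInit, Timed.bind_cost, Timed.pure_cost, Timed.sum, Timed.tabulate, Timed.abs,
    Timed.div, Finset.sum_const, Finset.card_univ, smul_eq_mul]
  nlinarith

theorem sinkhornTest_cost_le [Nonempty ι] [Nonempty κ] (r : ι → ℝ) (c : κ → ℝ) (δ : ℝ)
    (s : SinkhornState ι κ) :
    (sinkhornTest r c δ s).cost ≤ 14 * (Fintype.card ι * Fintype.card κ) := by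
  have hι : 1 ≤ Fintype.card ι := Fintype.card_pos
  have hκ : 1 ≤ Fintype.card κ := Fintype.card_pos
  simp only [sinkhornTest, rowSums, colSums, vecSub, vecNorm1, Timed.bind_cost, Timed.pure_cost,
    Timed.sum, Timed.tabulate, Timed.abs, Timed.add, Timed.lt, Timed.sub, Finset.sum_const,
    Finset.card_univ, smul_eq_mul]
  nlinarith

theorem sinkhornBody_cost_le [Nonempty ι] [Nonempty κ] (K : ι → κ → ℝ) (r : ι → ℝ) (c : κ → ℝ)
    (s : SinkhornState ι κ) :
    (sinkhornBody K r c s).cost ≤ 17 * (Fintype.card ι * Fintype.card κ) := by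
  have hι : 1 ≤ Fintype.card ι := Fintype.card_pos
  have hκ : 1 ≤ Fintype.card κ := Fintype.card_pos
  simp only [sinkhornBody, Timed.bind_cost]
  split <;>
  · simp only [rowSums, colSums, logRatio, vecAdd, scaled, Timed.natSucc, Timed.natOdd,
      Timed.bind_cost, Timed.pure_cost, Timed.sum, Timed.tabulate, Timed.add, Timed.div, Timed.log,
      Timed.exp, Timed.mul, Finset.sum_const, Finset.card_univ, smul_eq_mul]
    nlinarith

theorem exists_sinkhornRuns_sinkhornState [Nonempty ι] [Nonempty κ] {δ : ℝ} {k : ℕ}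
    (hlt : ∀ i < k, δ < marginalError r c (sinkhornState K r c i).X)
    (hle : marginalError r c (sinkhornState K r c k).X ≤ δ) :
    ∃ t, SinkhornRuns K r c δ (sinkhornState K r c k).X t ∧
      t ≤ (9 + 31 * (k + 1)) * (Fintype.card ι * Fintype.card κ) := by
  obtain ⟨t, hrun, ht⟩ := Timed.exists_whileRuns (test := sinkhornTest r c δ)
    (body := sinkhornBody K r c) (B := 31 * (Fintype.card ι * Fintype.card κ))
    (fun s => by linarith [sinkhornTest_cost_le r c δ s, sinkhornBody_cost_le K r c s])
    k (sinkhornInit K).val (fun i hi => decide_eq_true (hlt i hi))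
    (decide_eq_false (not_lt.2 hle))
  exact ⟨_, ⟨_, t, hrun, rfl, rfl⟩, by linarith [sinkhornInit_cost_le K]⟩

theorem IsSinkhornInput.exists_sinkhornRuns (h : IsSinkhornInput K r c M b) {δ : ℝ} (hδ : 0 ≤ δ)
    (hM : δ = 0 → M = 0) :
    ∃ k t, SinkhornRuns K r c δ (sinkhornState K r c k).X t ∧
      marginalError r c (sinkhornState K r c k).X ≤ δ ∧
      (t : ℝ) ≤ (102 + 124 * (M / δ ^ 2)) * (Fintype.card ι * Fintype.card κ) := by
  have := h.nonempty_rows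
  have := h.nonempty_cols
  obtain ⟨k, hlt, hle, hk⟩ := h.exists_forall_lt_and_marginalError_le hδ hM
  obtain ⟨t, hrun, ht⟩ := exists_sinkhornRuns_sinkhornState hlt hle
  refine ⟨k, t, hrun, hle, ?_⟩
  calc (t : ℝ) ≤ (9 + 31 * (k + 1)) * (Fintype.card ι * Fintype.card κ) := by exact_mod_cast ht
    _ ≤ (102 + 124 * (M / δ ^ 2)) * (Fintype.card ι * Fintype.card κ) := by
        rw [mul_div_assoc] at hk
        exact mul_le_mul_of_nonneg_right (by linarith) (by positivity)

end RunningTime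

/-! ### Rounding to a coupling -/

section CapRows

variable {ι κ : Type*} [Fintype κ] {F : ι → κ → ℝ} {r : ι → ℝ}

/-- The matrix `diag(min(r / (F 1), 1)) F`, whose row sums are at most `r`. -/
def capRows (r : ι → ℝ) (F : ι → κ → ℝ) (i : ι) (j : κ) : ℝ := min (r i / ∑ j, F i j) 1 * F i j

theorem capRows_le (hF : ∀ i j, 0 ≤ F i j) (i : ι) (j : κ) : capRows r F i j ≤ F i j :=
  mul_le_of_le_one_left (hF i j) (min_le_right _ _)

theorem capRows_nonneg (hr : ∀ i, 0 ≤ r i) (hF : ∀ i j, 0 ≤ F i j) (i : ι) (j : κ) :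
    0 ≤ capRows r F i j :=
  mul_nonneg (le_min (div_nonneg (hr i) (Finset.sum_nonneg fun j _ => hF i j)) zero_le_one)
    (hF i j)

theorem sum_capRows (hr : ∀ i, 0 ≤ r i) (hF : ∀ i j, 0 ≤ F i j) (i : ι) :
    ∑ j, capRows r F i j = min (r i) (∑ j, F i j) := by
  have hsum : 0 ≤ ∑ j, F i j := Finset.sum_nonneg fun j _ => hF i j
  simp_rw [capRows, ← Finset.mul_sum]
  obtain hzero | hpos := hsum.eq_or_lt
  · rw [← hzero, mul_zero, min_eq_right (hr i)]
  · rw [min_mul_of_nonneg _ _ hsum, div_mul_cancel₀ _ hpos.ne', one_mul]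

theorem sum_capRows_le (hr : ∀ i, 0 ≤ r i) (hF : ∀ i j, 0 ≤ F i j) (i : ι) :
    ∑ j, capRows r F i j ≤ r i :=
  (sum_capRows hr hF i).trans_le (min_le_left _ _)

theorem sum_sub_capRows_le (hr : ∀ i, 0 ≤ r i) (hF : ∀ i j, 0 ≤ F i j) (i : ι) :
    ∑ j, (F i j - capRows r F i j) = max (∑ j, F i j - r i) 0 := by
  rw [Finset.sum_sub_distrib, sum_capRows hr hF, ← max_sub_sub_left, sub_self]

end CapRows

section Correction

variable {ι κ : Type*} [Fintype ι] {x : ι → ℝ} {y : κ → ℝ}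

/-- The rank-one matrix `x yᵀ / ‖x‖₁`, which is zero for `x = 0`. -/
def correction (x : ι → ℝ) (y : κ → ℝ) (i : ι) (j : κ) : ℝ := x i * y j / ∑ i, |x i|

theorem correction_nonneg (hx : ∀ i, 0 ≤ x i) (hy : ∀ j, 0 ≤ y j) (i : ι) (j : κ) :
    0 ≤ correction x y i j :=
  div_nonneg (mul_nonneg (hx i) (hy j)) (Finset.sum_nonneg fun i _ => abs_nonneg (x i))

theorem row_sum_correction [Fintype κ] (hx : ∀ i, 0 ≤ x i) (hxy : ∑ i, x i = ∑ j, y j) (i : ι) :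
    ∑ j, correction x y i j = x i := by
  simp_rw [correction, ← Finset.sum_div, ← Finset.mul_sum, ← hxy, abs_of_nonneg (hx _)]
  refine mul_div_cancel_of_imp fun hzero => ?_
  exact (Finset.sum_eq_zero_iff_of_nonneg fun i _ => hx i).1 hzero i (Finset.mem_univ i)

theorem col_sum_correction [Fintype κ] (hx : ∀ i, 0 ≤ x i) (hy : ∀ j, 0 ≤ y j)
    (hxy : ∑ i, x i = ∑ j, y j) (j : κ) : ∑ i, correction x y i j = y j := by
  simp_rw [correction, ← Finset.sum_div, ← Finset.sum_mul, abs_of_nonneg (hx _), hxy]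
  refine mul_div_cancel_left_of_imp fun hzero => ?_
  exact (Finset.sum_eq_zero_iff_of_nonneg fun j _ => hy j).1 hzero j (Finset.mem_univ j)

end Correction

section Round

variable {ι κ : Type} [Fintype ι] [Fintype κ] {F G : ι → κ → ℝ} {r : ι → ℝ} {c : κ → ℝ}

/-- The matrix `F''` of `Round`, obtained from `F` by capping the row sums and then the column
sums. -/
def capBoth (r : ι → ℝ) (c : κ → ℝ) (F : ι → κ → ℝ) : ι → κ → ℝ :=
  flip (capRows c (flip (capRows r F)))

theorem round_val (F : ι → κ → ℝ) (r : ι → ℝ) (c : κ → ℝ) :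
    (round F r c).val = fun i j => capBoth r c F i j +
      correction (fun i => r i - ∑ j, capBoth r c F i j)
        (fun j => c j - ∑ i, capBoth r c F i j) i j := by
  have hcap : capBoth r c F =
      fun i j => capRows r F i j * min (c j / ∑ i, capRows r F i j) 1 := by
    funext i j
    exact mul_comm _ _
  rw [hcap]
  rfl

theorem capBoth_nonneg (hr : ∀ i, 0 ≤ r i) (hc : ∀ j, 0 ≤ c j) (hF : ∀ i j, 0 ≤ F i j) (i : ι)
    (j : κ) : 0 ≤ capBoth r c F i j :=
  capRows_nonneg hc (fun j i => capRows_nonneg hr hF i j) j i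

theorem capBoth_le_capRows (hr : ∀ i, 0 ≤ r i) (hF : ∀ i j, 0 ≤ F i j) (i : ι) (j : κ) :
    capBoth r c F i j ≤ capRows r F i j :=
  capRows_le (fun j i => capRows_nonneg hr hF i j) j i

theorem row_sum_capBoth_le (hr : ∀ i, 0 ≤ r i) (hF : ∀ i j, 0 ≤ F i j) (i : ι) :
    ∑ j, capBoth r c F i j ≤ r i :=
  (Finset.sum_le_sum fun j _ => capBoth_le_capRows hr hF i j).trans (sum_capRows_le hr hF i)

theorem col_sum_capBoth_le (hr : ∀ i, 0 ≤ r i) (hc : ∀ j, 0 ≤ c j) (hF : ∀ i j, 0 ≤ F i j)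
    (j : κ) : ∑ i, capBoth r c F i j ≤ c j :=
  sum_capRows_le hc (fun j i => capRows_nonneg hr hF i j) j

theorem sum_sub_row_sums_eq (hrc : ∑ i, r i = ∑ j, c j) (G : ι → κ → ℝ) :
    ∑ i, (r i - ∑ j, G i j) = ∑ j, (c j - ∑ i, G i j) := by
  rw [Finset.sum_sub_distrib, Finset.sum_sub_distrib, hrc, Finset.sum_comm]

theorem round_mem_couplings (hr : ∀ i, 0 ≤ r i) (hc : ∀ j, 0 ≤ c j) (hF : ∀ i j, 0 ≤ F i j)
    (hrc : ∑ i, r i = ∑ j, c j) : (round F r c).val ∈ couplings r c := by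
  have hrow : ∀ i, 0 ≤ r i - ∑ j, capBoth r c F i j := fun i =>
    sub_nonneg.2 (row_sum_capBoth_le hr hF i)
  have hcol : ∀ j, 0 ≤ c j - ∑ i, capBoth r c F i j := fun j =>
    sub_nonneg.2 (col_sum_capBoth_le hr hc hF j)
  have hmass := sum_sub_row_sums_eq hrc (capBoth r c F)
  rw [round_val]
  refine ⟨fun i j => add_nonneg (capBoth_nonneg hr hc hF i j) (correction_nonneg hrow hcol i j),
    fun i => ?_, fun j => ?_⟩
  · rw [Finset.sum_add_distrib, row_sum_correction hrow hmass, add_sub_cancel]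
  · rw [Finset.sum_add_distrib, col_sum_correction hrow hcol hmass, add_sub_cancel]

theorem sum_sub_capBoth_le (hr : ∀ i, 0 ≤ r i) (hc : ∀ j, 0 ≤ c j) (hF : ∀ i j, 0 ≤ F i j) :
    ∑ i, ∑ j, (F i j - capBoth r c F i j) ≤ marginalError r c F := by
  have hrows : ∀ i, ∑ j, (F i j - capRows r F i j) ≤ |∑ j, F i j - r i| := fun i => by
    rw [sum_sub_capRows_le hr hF]
    exact max_le (le_abs_self _) (abs_nonneg _)
  have hcols : ∀ j, ∑ i, (capRows r F i j - capBoth r c F i j) ≤ |∑ i, F i j - c j| := fun j => by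
    have hle : ∑ i, capRows r F i j ≤ ∑ i, F i j :=
      Finset.sum_le_sum fun i _ => capRows_le hF i j
    calc ∑ i, (capRows r F i j - capBoth r c F i j) = max (∑ i, capRows r F i j - c j) 0 :=
          sum_sub_capRows_le hc (fun j i => capRows_nonneg hr hF i j) j
      _ ≤ |∑ i, F i j - c j| := max_le (by linarith [le_abs_self (∑ i, F i j - c j)])
          (abs_nonneg _)
  calc ∑ i, ∑ j, (F i j - capBoth r c F i j)
      = ∑ i, ∑ j, (F i j - capRows r F i j) +
          ∑ j, ∑ i, (capRows r F i j - capBoth r c F i j) := by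
        rw [Finset.sum_comm (γ := κ)]
        simp_rw [← Finset.sum_add_distrib, sub_add_sub_cancel]
    _ ≤ marginalError r c F :=
        add_le_add (Finset.sum_le_sum fun i _ => hrows i) (Finset.sum_le_sum fun j _ => hcols j)

theorem sum_sub_row_sums_capBoth_le (hr : ∀ i, 0 ≤ r i) (hc : ∀ j, 0 ≤ c j)
    (hF : ∀ i j, 0 ≤ F i j) :
    ∑ i, (r i - ∑ j, capBoth r c F i j) ≤ 2 * marginalError r c F := by
  have hdeficit : ∑ i, (r i - ∑ j, F i j) ≤ marginalError r c F :=
    le_add_of_le_of_nonneg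
      (Finset.sum_le_sum fun i _ => (le_abs_self _).trans_eq (abs_sub_comm _ _))
      (Finset.sum_nonneg fun j _ => abs_nonneg _)
  have hsplit : ∑ i, (r i - ∑ j, capBoth r c F i j) =
      ∑ i, ∑ j, (F i j - capBoth r c F i j) + ∑ i, (r i - ∑ j, F i j) := by
    simp_rw [Finset.sum_sub_distrib]
    ring
  linarith [sum_sub_capBoth_le hr hc hF]

theorem norm1_round_sub_le (hr : ∀ i, 0 ≤ r i) (hc : ∀ j, 0 ≤ c j) (hF : ∀ i j, 0 ≤ F i j)
    (hrc : ∑ i, r i = ∑ j, c j) :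
    norm1 (fun i j => (round F r c).val i j - F i j) ≤ 3 * marginalError r c F := by
  set R := correction (fun i => r i - ∑ j, capBoth r c F i j) fun j =>
    c j - ∑ i, capBoth r c F i j with hR
  have hrow : ∀ i, 0 ≤ r i - ∑ j, capBoth r c F i j := fun i =>
    sub_nonneg.2 (row_sum_capBoth_le hr hF i)
  have hRnonneg : ∀ i j, 0 ≤ R i j :=
    correction_nonneg hrow fun j => sub_nonneg.2 (col_sum_capBoth_le hr hc hF j)
  have hentry : ∀ i j, |(round F r c).val i j - F i j| ≤ (F i j - capBoth r c F i j) + R i j :=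
    fun i j => by
      have hle := (capBoth_le_capRows (c := c) hr hF i j).trans (capRows_le hF i j)
      rw [round_val, ← hR, abs_le]
      constructor <;> linarith [hRnonneg i j]
  calc norm1 (fun i j => (round F r c).val i j - F i j)
      ≤ ∑ i, ∑ j, ((F i j - capBoth r c F i j) + R i j) :=
        Finset.sum_le_sum fun i _ => Finset.sum_le_sum fun j _ => hentry i j
    _ = ∑ i, ∑ j, (F i j - capBoth r c F i j) + ∑ i, (r i - ∑ j, capBoth r c F i j) := by
        simp_rw [Finset.sum_add_distrib, hR,
          row_sum_correction hrow (sum_sub_row_sums_eq hrc (capBoth r c F))]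
    _ ≤ 3 * marginalError r c F := by
        linarith [sum_sub_capBoth_le hr hc hF, sum_sub_row_sums_capBoth_le hr hc hF]

theorem round_cost_le [Nonempty ι] [Nonempty κ] (F : ι → κ → ℝ) (r : ι → ℝ) (c : κ → ℝ) :
    (round F r c).cost ≤ 36 * (Fintype.card ι * Fintype.card κ) := by
  have hι : 1 ≤ Fintype.card ι := Fintype.card_pos
  have hκ : 1 ≤ Fintype.card κ := Fintype.card_pos
  simp only [round, rowSums, colSums, cappedRatio, vecSub, vecNorm1, Timed.bind_cost,
    Timed.pure_cost, Timed.sum, Timed.tabulate, Timed.add, Timed.sub, Timed.mul, Timed.div,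
    Timed.min, Timed.abs, Finset.sum_const, Finset.card_univ, smul_eq_mul]
  nlinarith

end Round

/-! ### Accuracy of `Sinkhorn` followed by `Round` -/

section Accuracy

variable {ι κ : Type} [Fintype ι] [Fintype κ] {K X Y : ι → κ → ℝ} {u : ι → ℝ} {v : κ → ℝ}
  {r : ι → ℝ} {c : κ → ℝ} {M b δ ε : ℝ}

theorem SinkhornInvariant.sq_norm1_normalize_sub_le {s : SinkhornState ι κ}
    (hs : SinkhornInvariant K (M - log b) s) (h : IsSinkhornInput K r c M b)
    (hX : IsScaling K u v X) (hXc : X ∈ couplings r c) :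
    norm1 (fun i j => normalize s.X i j - X i j) ^ 2 ≤
      2 * (M - log b) * marginalError r c s.X := by
  have := h.nonempty_rows
  have := h.nonempty_cols
  obtain ⟨a, ha⟩ := hs.isScaling
  have hpos := ha.pos h.kernel_pos
  have hsum := sum_sum_pos hpos
  calc norm1 (fun i j => normalize s.X i j - X i j) ^ 2
      ≤ (M - log b) * marginalError r c (normalize s.X) :=
        sq_norm1_sub_le_of_isScaling h.kernel_pos (ha.normalize hsum) hX
          ((hs.oscLE_left.add_const _).add_const _) hs.oscLE_right (h.oscLE_left hX hXc.2.1)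
          (h.oscLE_right hX hXc.2.2) (sum_normalize hsum.ne') hXc h.row_mem.2
    _ ≤ (M - log b) * (2 * marginalError r c s.X) :=
        mul_le_mul_of_nonneg_left (marginalError_normalize_le (fun i j => (hpos i j).le) hsum
          h.row_mem.2 h.col_mem.2) h.log_bound_nonneg
    _ = 2 * (M - log b) * marginalError r c s.X := by ring

theorem SinkhornInvariant.norm1_round_sub_le {s : SinkhornState ι κ}
    (hs : SinkhornInvariant K (M - log b) s) (h : IsSinkhornInput K r c M b)
    (hX : IsScaling K u v X) (hXc : X ∈ couplings r c) (hε : 0 ≤ ε)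
    (herror : marginalError r c s.X ≤ ε / 8)
    (hbound : 2 * (M - log b) * marginalError r c s.X ≤ ε ^ 2 / 4) :
    norm1 (fun i j => (round s.X r c).val i j - X i j) ≤ ε := by
  have := h.nonempty_rows
  have := h.nonempty_cols
  obtain ⟨a, ha⟩ := hs.isScaling
  have hpos := ha.pos h.kernel_pos
  have hrounding := EntropicOT.norm1_round_sub_le (fun i => (h.row_pos i).le)
    (fun j => (h.col_pos j).le) (fun i j => (hpos i j).le) (h.row_mem.2.trans h.col_mem.2.symm)
  have hnormalization := norm1_sub_normalize (fun i j => (hpos i j).le) (sum_sum_pos hpos)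
  have hmass := two_mul_abs_sum_sub_one_le (X := s.X) h.row_mem.2 h.col_mem.2
  have hstability : norm1 (fun i j => normalize s.X i j - X i j) ≤ ε / 2 :=
    le_of_sq_le_sq (by linarith [hs.sq_norm1_normalize_sub_le h hX hXc]) (by positivity)
  linarith [norm1_sub_le (round s.X r c).val s.X X, norm1_sub_le s.X (normalize s.X) X]

theorem eq_of_mem_couplings [Subsingleton κ] (hX : X ∈ couplings r c) (hY : Y ∈ couplings r c) :
    X = Y := by
  funext i j
  have hrow := (hX.2.1 i).trans (hY.2.1 i).symm
  rwa [Fintype.sum_subsingleton _ j, Fintype.sum_subsingleton _ j] at hrow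

theorem IsSinkhornInput.log_card_rows_le (h : IsSinkhornInput K r c M b) :
    log (Fintype.card ι) ≤ M - log b := by
  have := h.nonempty_rows
  have hcard : (0 : ℝ) < Fintype.card ι := by exact_mod_cast Fintype.card_pos
  have hle : Fintype.card ι * b ≤ 1 := by
    rw [← h.row_mem.2, ← nsmul_eq_mul]
    exact Finset.card_nsmul_le_sum _ _ _ fun i _ => h.le_row i
  have hlog := log_nonpos (mul_pos hcard h.floor_pos).le hle
  rw [log_mul hcard.ne' h.floor_pos.ne'] at hlog
  linarith [h.exponent_nonneg]

theorem IsSinkhornInput.log_max_card_le (h : IsSinkhornInput K r c M b) :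
    log (max (Fintype.card ι) (Fintype.card κ) : ℕ) ≤ M - log b := by
  rcases max_choice (Fintype.card ι) (Fintype.card κ) with hmax | hmax <;> rw [hmax]
  exacts [h.log_card_rows_le, h.flip.log_card_rows_le]

end Accuracy

section Tolerance

variable {d : ℕ} {J M L ε : ℝ}

/-- The accuracy `ε'` with which `ApproxOT` calls `Sinkhorn`, where `d` is the larger of the number
of rows and the number of columns. -/
def tolerance (d : ℕ) (J ε : ℝ) : ℝ :=
  if d ≤ 2 then ε * ε / (8 * J) * log 2 else ε * ε / (8 * J)

theorem tolerance_le_sq_div (hJ : 0 ≤ J) : tolerance d J ε ≤ ε ^ 2 / (8 * J) := by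
  have hnonneg : 0 ≤ ε ^ 2 / (8 * J) := by positivity
  unfold tolerance
  rw [← sq]
  split_ifs
  · exact mul_le_of_le_one_right hnonneg (by linarith [log_two_lt_d9])
  · exact le_rfl

theorem sq_div_le_tolerance (hJ : 0 ≤ J) : ε ^ 2 / (16 * J) ≤ tolerance d J ε := by
  have hnonneg : 0 ≤ ε ^ 2 / (8 * J) := by positivity
  have hhalf : ε ^ 2 / (16 * J) = ε ^ 2 / (8 * J) * (1 / 2) := by
    rw [← mul_div_mul_comm]
    ring
  unfold tolerance
  rw [← sq, hhalf]
  split_ifs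
  · exact mul_le_mul_of_nonneg_left (by linarith [log_two_gt_d9]) hnonneg
  · exact mul_le_of_le_one_right hnonneg (by norm_num)

theorem tolerance_nonneg (hJ : 0 ≤ J) : 0 ≤ tolerance d J ε :=
  le_trans (by positivity) (sq_div_le_tolerance hJ)

theorem tolerance_pos (hJ : 0 < J) (hε : 0 < ε) : 0 < tolerance d J ε :=
  lt_of_lt_of_le (by positivity) (sq_div_le_tolerance hJ.le)

theorem two_mul_mul_tolerance_le (hJ : 0 < J) : 2 * J * tolerance d J ε ≤ ε ^ 2 / 4 :=
  calc 2 * J * tolerance d J ε ≤ 2 * J * (ε ^ 2 / (8 * J)) := by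
        gcongr
        exact tolerance_le_sq_div hJ.le
    _ = ε ^ 2 / 4 := by
        field_simp
        ring

/-- For `d = 2` only `log 2 ≤ J` is known, which the factor `log 2` in `tolerance` absorbs. -/
theorem tolerance_le (hε : 0 < ε) (hε1 : ε < 1) (hd : 2 ≤ d) (hJ : log d ≤ J) :
    tolerance d J ε ≤ ε / 8 := by
  have hlog : 0 < log 2 := log_pos one_lt_two
  have hlogJ : log 2 ≤ J := (log_le_log two_pos (by exact_mod_cast hd)).trans hJ
  have hJ0 : 0 < J := hlog.trans_le hlogJ
  have hsq : ε * ε ≤ ε := mul_le_of_le_one_left hε.le hε1.le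
  unfold tolerance
  split_ifs with hsmall
  · rw [div_mul_eq_mul_div, div_le_iff₀ (by positivity)]
    linarith [mul_le_mul hsq hlogJ hlog.le hε.le]
  · have hd3 : (3 : ℝ) ≤ d := by exact_mod_cast not_le.1 hsmall
    have hJ1 : 1 ≤ J := by
      refine le_trans ?_ hJ
      rw [le_log_iff_exp_le (by linarith)]
      linarith [exp_one_lt_d9]
    rw [div_le_iff₀ (by positivity)]
    linarith [le_mul_of_one_le_right hε.le hJ1]

theorem div_sq_tolerance_le (hM : 0 ≤ M) (hL : 0 ≤ L) (hε : 0 < ε) :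
    M / tolerance d (M + L) ε ^ 2 ≤ 512 * ((ε ^ 4)⁻¹ * M * (M ^ 2 + L ^ 2)) := by
  rcases hM.eq_or_lt with rfl | hMpos
  · simp
  calc M / tolerance d (M + L) ε ^ 2 ≤ M / (ε ^ 2 / (16 * (M + L))) ^ 2 := by
        gcongr
        exact sq_div_le_tolerance (by positivity)
    _ = 256 * ((ε ^ 4)⁻¹ * M * (M + L) ^ 2) := by
        field_simp
        norm_num
    _ ≤ 256 * ((ε ^ 4)⁻¹ * M * (2 * (M ^ 2 + L ^ 2))) := by
        gcongr
        exact add_sq_le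
    _ = 512 * ((ε ^ 4)⁻¹ * M * (M ^ 2 + L ^ 2)) := by ring

end Tolerance

section SinkhornRound

variable {ι κ : Type} [Fintype ι] [Fintype κ] {K X : ι → κ → ℝ} {u : ι → ℝ} {v : κ → ℝ}
  {r : ι → ℝ} {c : κ → ℝ} {M b ε : ℝ}

namespace IsSinkhornInput

theorem round_sinkhornState_mem_couplings (h : IsSinkhornInput K r c M b) (k : ℕ) :
    (round (sinkhornState K r c k).X r c).val ∈ couplings r c :=
  round_mem_couplings (fun i => (h.row_pos i).le) (fun j => (h.col_pos j).le)
    (fun i j => (h.sinkhornState_pos k i j).le) (h.row_mem.2.trans h.col_mem.2.symm)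

theorem norm1_round_sinkhornState_sub_le (h : IsSinkhornInput K r c M b)
    (hX : IsScaling K u v X) (hXc : X ∈ couplings r c) (hε : 0 < ε) (hε1 : ε < 1) {k : ℕ}
    (hk : marginalError r c (sinkhornState K r c k).X ≤
      tolerance (max (Fintype.card ι) (Fintype.card κ)) (M - log b) ε) :
    norm1 (fun i j => (round (sinkhornState K r c k).X r c).val i j - X i j) ≤ ε := by
  rcases le_or_gt (max (Fintype.card ι) (Fintype.card κ)) 1 with hsmall | hlarge
  · have : Subsingleton κ :=
      Fintype.card_le_one_iff_subsingleton.1 ((le_max_right _ _).trans hsmall)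
    rw [eq_of_mem_couplings (h.round_sinkhornState_mem_couplings k) hXc]
    simpa [norm1] using hε.le
  · have hJ : 0 < M - log b := (log_pos (by exact_mod_cast hlarge)).trans_le h.log_max_card_le
    refine (h.invariant_sinkhornState k).norm1_round_sub_le h hX hXc hε.le
      (hk.trans (tolerance_le hε hε1 hlarge h.log_max_card_le))
      (le_trans ?_ (two_mul_mul_tolerance_le (d := max (Fintype.card ι) (Fintype.card κ)) hJ))
    gcongr

theorem exists_sinkhornRuns_round (h : IsSinkhornInput K r c M b) (hX : IsScaling K u v X)
    (hXc : X ∈ couplings r c) (hε : 0 < ε) (hε1 : ε < 1) :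
    ∃ X' t, SinkhornRuns K r c
        (tolerance (max (Fintype.card ι) (Fintype.card κ)) (M - log b) ε) X' t ∧
      (round X' r c).val ∈ couplings r c ∧
      norm1 (fun i j => (round X' r c).val i j - X i j) ≤ ε ∧
      (t : ℝ) ≤ (102 + 63488 * ((ε ^ 4)⁻¹ * M * (M ^ 2 + log b⁻¹ ^ 2))) *
        (Fintype.card ι * Fintype.card κ) := by
  have hM := h.exponent_nonneg
  have hlog := h.log_floor_nonpos
  obtain ⟨k, t, hrun, hk, ht⟩ := h.exists_sinkhornRuns (tolerance_nonneg h.log_bound_nonneg)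
    fun hzero => by
      have hJ : ¬ 0 < M - log b := fun hJ => (tolerance_pos hJ hε).ne' hzero
      linarith
  refine ⟨_, t, hrun, h.round_sinkhornState_mem_couplings k,
    h.norm1_round_sinkhornState_sub_le hX hXc hε hε1 hk, ht.trans ?_⟩
  have hiterations := div_sq_tolerance_le (d := max (Fintype.card ι) (Fintype.card κ)) hM
    (neg_nonneg.2 hlog) hε
  rw [← sub_eq_add_neg] at hiterations
  rw [log_inv]
  exact mul_le_mul_of_nonneg_right (by linarith) (by positivity)

end IsSinkhornInput

theorem isSinkhornInput_exp_neg_mul {C : ι → κ → ℝ} {ξ : ℝ} (hr : r ∈ stdSimplex ℝ ι)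
    (hc : c ∈ stdSimplex ℝ κ) (hr0 : ∀ i, 0 < r i) (hc0 : ∀ j, 0 < c j) (hC : ∀ i j, 0 ≤ C i j)
    (hξ : 0 ≤ ξ) :
    IsSinkhornInput (fun i j => exp (-(ξ * C i j))) r c (ξ * normInf C) (minEntry r c) where
  kernel_pos _ _ := exp_pos _
  kernel_le i j i' j' := by
    have hle : C i' j' ≤ normInf C :=
      calc C i' j' ≤ |C i' j'| := le_abs_self _
        _ ≤ ⨆ j, |C i' j| := le_ciSup (Finite.bddAbove_range fun j => |C i' j|) j'
        _ ≤ normInf C := le_ciSup (Finite.bddAbove_range fun i => ⨆ j, |C i j|) i'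
    rw [← exp_add, exp_le_exp]
    linarith [mul_nonneg hξ (hC i j), mul_le_mul_of_nonneg_left hle hξ]
  row_mem := hr
  col_mem := hc
  floor_pos := by
    have := nonempty_of_mem_stdSimplex hr
    have := nonempty_of_mem_stdSimplex hc
    obtain ⟨i, hi⟩ := exists_eq_ciInf_of_finite (f := r)
    obtain ⟨j, hj⟩ := exists_eq_ciInf_of_finite (f := c)
    rw [minEntry, ← hi, ← hj]
    exact lt_min (hr0 i) (hc0 j)
  le_row i := (min_le_left _ _).trans (ciInf_le (Finite.bddBelow_range r) i)
  le_col j := (min_le_right _ _).trans (ciInf_le (Finite.bddBelow_range c) j)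

end SinkhornRound

/-! ### Restriction to the support of the marginals -/

section Support

variable {m n : ℕ} {r : Fin m → ℝ} {c : Fin n → ℝ} {C X : Fin m → Fin n → ℝ}
  {Y Z : Pos r → Pos c → ℝ} {ξ : ℝ}

/-- The entries of a matrix in the positive rows and columns, the submatrix with which `ApproxOT`
computes. -/
def restrict (r : Fin m → ℝ) (c : Fin n → ℝ) (X : Fin m → Fin n → ℝ) (i : Pos r) (j : Pos c) : ℝ :=
  X i j

theorem sum_pos_eq_sum {f : Fin m → ℝ} (hf : ∀ i, ¬ 0 < r i → f i = 0) :
    ∑ i : Pos r, f i = ∑ i, f i := by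
  rw [← Fintype.sum_subtype_add_sum_subtype (fun i => 0 < r i) f, left_eq_add]
  exact Finset.sum_eq_zero fun i _ => hf i i.2

theorem restrict_mem_stdSimplex (hr : r ∈ stdSimplex ℝ (Fin m)) :
    (fun i : Pos r => r i) ∈ stdSimplex ℝ (Pos r) :=
  ⟨fun i => hr.1 i, (sum_pos_eq_sum fun i hi => (not_lt.1 hi).antisymm (hr.1 i)).trans hr.2⟩

theorem sum_sum_pos_eq_sum_sum {f : Fin m → Fin n → ℝ}
    (hf : ∀ i j, ¬ (0 < r i ∧ 0 < c j) → f i j = 0) :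
    ∑ i : Pos r, ∑ j : Pos c, f i j = ∑ i, ∑ j, f i j := by
  rw [← sum_pos_eq_sum fun i hi => Finset.sum_eq_zero fun j _ => hf i j fun h => hi h.1]
  exact Finset.sum_congr rfl fun i _ => sum_pos_eq_sum fun j hj => hf i j fun h => hj h.2

theorem extend_apply (Y : Pos r → Pos c → ℝ) (i : Pos r) (j : Pos c) :
    (extend r c Y).val i j = Y i j :=
  dif_pos (⟨i.2, j.2⟩ : 0 < r i ∧ 0 < c j)

theorem extend_apply_eq_zero {i : Fin m} {j : Fin n} (h : ¬ (0 < r i ∧ 0 < c j)) :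
    (extend r c Y).val i j = 0 :=
  dif_neg h

theorem row_sum_extend (Y : Pos r → Pos c → ℝ) (i : Pos r) :
    ∑ j, (extend r c Y).val i j = ∑ j, Y i j := by
  rw [← sum_pos_eq_sum fun j hj => extend_apply_eq_zero fun h => hj h.2]
  exact Finset.sum_congr rfl fun j _ => extend_apply Y i j

theorem col_sum_extend (Y : Pos r → Pos c → ℝ) (j : Pos c) :
    ∑ i, (extend r c Y).val i j = ∑ i, Y i j := by
  rw [← sum_pos_eq_sum fun i hi => extend_apply_eq_zero fun h => hi h.1]
  exact Finset.sum_congr rfl fun i _ => extend_apply Y i j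

theorem extend_mem_couplings (hr : ∀ i, 0 ≤ r i) (hc : ∀ j, 0 ≤ c j)
    (hY : Y ∈ couplings (fun i : Pos r => r i) fun j : Pos c => c j) :
    (extend r c Y).val ∈ couplings r c := by
  refine ⟨fun i j => ?_, fun i => ?_, fun j => ?_⟩
  · by_cases h : 0 < r i ∧ 0 < c j
    · exact (hY.1 ⟨i, h.1⟩ ⟨j, h.2⟩).trans_eq (extend_apply Y ⟨i, h.1⟩ ⟨j, h.2⟩).symm
    · exact (extend_apply_eq_zero h).ge
  · by_cases hi : 0 < r i
    · exact (row_sum_extend Y ⟨i, hi⟩).trans (hY.2.1 _)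
    · rw [(not_lt.1 hi).antisymm (hr i)]
      exact Finset.sum_eq_zero fun j _ => extend_apply_eq_zero fun h => hi h.1
  · by_cases hj : 0 < c j
    · exact (col_sum_extend Y ⟨j, hj⟩).trans (hY.2.2 _)
    · rw [(not_lt.1 hj).antisymm (hc j)]
      exact Finset.sum_eq_zero fun i _ => extend_apply_eq_zero fun h => hj h.2

theorem apply_eq_zero_of_mem_couplings (hX : X ∈ couplings r c) {i : Fin m} {j : Fin n}
    (h : ¬ (0 < r i ∧ 0 < c j)) : X i j = 0 := by
  refine (hX.1 i j).antisymm' (not_lt.1 fun hpos => h ⟨?_, ?_⟩)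
  · rw [← hX.2.1 i]
    exact hpos.trans_le (Finset.single_le_sum (fun j _ => hX.1 i j) (Finset.mem_univ j))
  · rw [← hX.2.2 j]
    exact hpos.trans_le
      (Finset.single_le_sum (f := fun i => X i j) (fun i _ => hX.1 i j) (Finset.mem_univ i))

theorem restrict_mem_couplings (hX : X ∈ couplings r c) :
    restrict r c X ∈ couplings (fun i : Pos r => r i) fun j : Pos c => c j :=
  ⟨fun i j => hX.1 i j,
    fun i => (sum_pos_eq_sum fun _ hj => apply_eq_zero_of_mem_couplings hX fun h => hj h.2).trans
      (hX.2.1 i),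
    fun j => (sum_pos_eq_sum (f := fun i => X i j) fun _ hi =>
      apply_eq_zero_of_mem_couplings hX fun h => hi h.1).trans (hX.2.2 j)⟩

theorem extend_restrict (hX : X ∈ couplings r c) :
    (extend r c (restrict r c X)).val = X := by
  funext i j
  by_cases h : 0 < r i ∧ 0 < c j
  · exact extend_apply (restrict r c X) ⟨i, h.1⟩ ⟨j, h.2⟩
  · rw [extend_apply_eq_zero h, apply_eq_zero_of_mem_couplings hX h]

theorem restrict_extend (Y : Pos r → Pos c → ℝ) : restrict r c (extend r c Y).val = Y :=
  funext fun i => funext fun j => extend_apply Y i j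

theorem norm1_extend_sub_extend (Y Z : Pos r → Pos c → ℝ) :
    norm1 (fun i j => (extend r c Y).val i j - (extend r c Z).val i j) =
      norm1 fun i j => Y i j - Z i j := by
  unfold norm1
  rw [← sum_sum_pos_eq_sum_sum (r := r) (c := c) fun i j h => by
    simp only [extend_apply_eq_zero h, sub_zero, abs_zero]]
  simp_rw [extend_apply]

theorem objective_extend (C : Fin m → Fin n → ℝ) (ξ : ℝ) (Y : Pos r → Pos c → ℝ) :
    objective C ξ (extend r c Y).val = objective (restrict r c C) ξ Y := by
  unfold objective entropy
  rw [← sum_sum_pos_eq_sum_sum (r := r) (c := c) fun i j h => by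
      rw [extend_apply_eq_zero h, zero_mul],
    ← sum_sum_pos_eq_sum_sum (r := r) (c := c) fun i j h => by
      rw [extend_apply_eq_zero h, zero_mul]]
  simp_rw [extend_apply]
  rfl

theorem isOptimal_extend_iff (hr : ∀ i, 0 ≤ r i) (hc : ∀ j, 0 ≤ c j) :
    IsOptimal r c C ξ (extend r c Y).val ↔
      IsOptimal (fun i : Pos r => r i) (fun j : Pos c => c j) (restrict r c C) ξ Y := by
  constructor
  · rintro ⟨hY, hmin⟩
    refine ⟨?_, fun Z hZ => ?_⟩
    · rw [← restrict_extend Y]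
      exact restrict_mem_couplings hY
    · have hle : objective C ξ (extend r c Y).val ≤ _ := hmin (extend_mem_couplings hr hc hZ)
      rwa [objective_extend, objective_extend] at hle
  · rintro ⟨hY, hmin⟩
    refine ⟨extend_mem_couplings hr hc hY, fun X hX => ?_⟩
    have hle : objective (restrict r c C) ξ Y ≤ _ :=
      hmin (restrict_mem_couplings hX)
    rwa [← objective_extend, ← objective_extend, extend_restrict hX] at hle

theorem isOptimal_iff_eq_extend (hr : ∀ i, 0 ≤ r i) (hc : ∀ j, 0 ≤ c j)
    (hY : ∀ Z, IsOptimal (fun i : Pos r => r i) (fun j : Pos c => c j) (restrict r c C) ξ Z ↔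
      Z = Y) : IsOptimal r c C ξ X ↔ X = (extend r c Y).val := by
  constructor
  · intro hX
    have hrestrict := extend_restrict hX.1
    rw [← hrestrict, isOptimal_extend_iff hr hc, hY] at hX
    rw [← hrestrict, hX]
  · rintro rfl
    exact (isOptimal_extend_iff hr hc).2 ((hY Y).2 rfl)

theorem normInf_restrict (hr : ∀ i, 0 < r i) (hc : ∀ j, 0 < c j) :
    normInf (restrict r c C) = normInf C :=
  (Equiv.subtypeUnivEquiv hr).iSup_congr fun _ =>
    ((Equiv.subtypeUnivEquiv hc).iSup_congr fun _ => rfl).symm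

theorem minEntry_support (hr : ∀ i, 0 < r i) (hc : ∀ j, 0 < c j) :
    minEntry (fun i : Pos r => r i) (fun j : Pos c => c j) = minEntry r c :=
  congrArg₂ min ((Equiv.subtypeUnivEquiv hr).iInf_congr fun _ => rfl)
    ((Equiv.subtypeUnivEquiv hc).iInf_congr fun _ => rfl)

end Support

/-! ### The algorithm `ApproxOT` -/

section ApproxOT

variable {m n : ℕ} {r : Fin m → ℝ} {c : Fin n → ℝ} {C : Fin m → Fin n → ℝ} {ξ ε : ℝ}

theorem prepare_val (r : Fin m → ℝ) (c : Fin n → ℝ) (C : Fin m → Fin n → ℝ) (ξ ε : ℝ) :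
    (prepare r c C ξ ε).val = ⟨fun i => r i, fun j => c j,
      fun i j => exp (-(ξ * restrict r c C i j)),
      tolerance (max (Fintype.card (Pos r)) (Fintype.card (Pos c)))
        (ξ * normInf (restrict r c C)
          - log (minEntry (fun i : Pos r => r i) fun j : Pos c => c j)) ε⟩ := by
  have htolerance : ∀ d J ε, tolerance d J ε =
      if decide (d ≤ 2) = true then ε * ε / (8 * J) * log 2 else ε * ε / (8 * J) :=
    fun _ _ _ => by simp only [tolerance, decide_eq_true_eq]
  rw [htolerance]
  rfl

theorem card_pos_le (r : Fin m → ℝ) : Fintype.card (Pos r) ≤ m :=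
  (Fintype.card_subtype_le _).trans_eq (Fintype.card_fin m)

theorem prepare_cost_le [Nonempty (Pos r)] [Nonempty (Pos c)] (C : Fin m → Fin n → ℝ)
    (ξ ε : ℝ) : (prepare r c C ξ ε).cost ≤ 40 * (m * n) := by
  have hm : 1 ≤ m := Fintype.card_pos.trans_le (card_pos_le r)
  have hn : 1 ≤ n := Fintype.card_pos.trans_le (card_pos_le c)
  have hrow := card_pos_le r
  have hcol := card_pos_le c
  have hrowcol := Nat.mul_le_mul hrow hcol
  have hm' := Nat.le_mul_of_pos_right m hn
  have hn' := Nat.le_mul_of_pos_left n hm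
  simp only [prepare, Timed.bind_cost, Timed.pure_cost, Timed.tabulate, Timed.lt, Timed.maximum,
    Timed.minimum, Timed.abs, Timed.min, Timed.log, Timed.mul, Timed.sub, Timed.div, Timed.natMax,
    Timed.natLe, Timed.neg, Timed.exp, Finset.sum_const, Finset.card_univ, smul_eq_mul,
    Fintype.card_fin]
  linarith

theorem finish_cost_le [Nonempty (Pos r)] [Nonempty (Pos c)] (D : Restricted r c)
    (X : Pos r → Pos c → ℝ) : (finish r c D X).cost ≤ 38 * (m * n) := by
  have hn : 1 ≤ n := Fintype.card_pos.trans_le (card_pos_le c)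
  have hround := (round_cost_le X D.rPos D.cPos).trans
    (Nat.mul_le_mul_left 36 (Nat.mul_le_mul (card_pos_le r) (card_pos_le c)))
  simp only [finish, extend, Timed.bind_cost, Timed.pure_cost, Timed.tabulate, Finset.sum_const,
    Finset.card_univ, smul_eq_mul, Fintype.card_fin]
  linarith [Nat.le_mul_of_pos_right m hn]

theorem exists_approxOTRuns_of_sinkhornRuns [Nonempty (Pos r)] [Nonempty (Pos c)]
    {X : Pos r → Pos c → ℝ} {t : ℕ} {q : ℝ} (hq : 0 ≤ q)
    (hrun : SinkhornRuns (fun i j => exp (-(ξ * restrict r c C i j))) (fun i : Pos r => r i)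
      (fun j : Pos c => c j) (tolerance (max (Fintype.card (Pos r)) (Fintype.card (Pos c)))
        (ξ * normInf (restrict r c C)
          - log (minEntry (fun i : Pos r => r i) fun j : Pos c => c j)) ε) X t)
    (ht : (t : ℝ) ≤ (102 + q) * (Fintype.card (Pos r) * Fintype.card (Pos c))) :
    ∃ T, ApproxOTRuns r c C ξ ε
        (extend r c (round X (fun i : Pos r => r i) fun j : Pos c => c j).val).val T ∧
      (T : ℝ) ≤ (180 + q) * (m * n) := by
  refine ⟨_, ⟨X, t, ?_, ?_, rfl⟩, ?_⟩
  · rwa [prepare_val]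
  · rw [prepare_val]
    rfl
  · have hprepare : ((prepare r c C ξ ε).cost : ℝ) ≤ 40 * (m * n) := by
      exact_mod_cast prepare_cost_le C ξ ε
    have hfinish : ((finish r c (prepare r c C ξ ε).val X).cost : ℝ) ≤ 38 * (m * n) := by
      exact_mod_cast finish_cost_le (prepare r c C ξ ε).val X
    have hcard : (Fintype.card (Pos r) * Fintype.card (Pos c) : ℝ) ≤ m * n := by
      exact_mod_cast Nat.mul_le_mul (card_pos_le r) (card_pos_le c)
    push_cast
    linarith [mul_le_mul_of_nonneg_left hcard (by positivity : 0 ≤ 102 + q)]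

theorem isSinkhornInput_restrict (hr : r ∈ stdSimplex ℝ (Fin m)) (hc : c ∈ stdSimplex ℝ (Fin n))
    (hC : ∀ i j, 0 ≤ C i j) (hξ : 0 ≤ ξ) :
    IsSinkhornInput (fun i j => exp (-(ξ * restrict r c C i j))) (fun i : Pos r => r i)
      (fun j : Pos c => c j) (ξ * normInf (restrict r c C))
      (minEntry (fun i : Pos r => r i) fun j : Pos c => c j) :=
  isSinkhornInput_exp_neg_mul (restrict_mem_stdSimplex hr) (restrict_mem_stdSimplex hc)
    (fun i => i.2) (fun j => j.2) (fun i j => hC i j) hξ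

end ApproxOT

end EntropicOT

end

theorem mainTheorem9_general {m n : ℕ} {r : Fin m → ℝ} {c : Fin n → ℝ} {C : Fin m → Fin n → ℝ}
    {ξ ε : ℝ} (hr : r ∈ stdSimplex ℝ (Fin m)) (hc : c ∈ stdSimplex ℝ (Fin n))
    (hC : ∀ i j, 0 ≤ C i j) (hξ : 0 < ξ) (hε : 0 < ε) (hε1 : ε < 1) :
    ∃ (Xopt Xhat : Fin m → Fin n → ℝ) (T : ℕ),
      (∀ X, EntropicOT.IsOptimal r c C ξ X ↔ X = Xopt) ∧
      EntropicOT.ApproxOTRuns r c C ξ ε Xhat T ∧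
      Xhat ∈ EntropicOT.couplings r c ∧
      EntropicOT.norm1 (fun i j => Xhat i j - Xopt i j) ≤ ε ∧
      (T : ℝ) ≤ 63488 *
        ((m : ℝ) * n * (ε ^ 4)⁻¹ * (ξ * EntropicOT.normInf (EntropicOT.restrict r c C)) *
            (ξ ^ 2 * EntropicOT.normInf (EntropicOT.restrict r c C) ^ 2 +
              Real.log (EntropicOT.minEntry (fun i : EntropicOT.Pos r => r i)
                fun j : EntropicOT.Pos c => c j)⁻¹ ^ 2) +
          (m : ℝ) * n) := by
  have h := EntropicOT.isSinkhornInput_restrict hr hc hC hξ.le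
  have := h.nonempty_rows
  have := h.nonempty_cols
  obtain ⟨X, u, v, hX, hXc⟩ := h.exists_isScaling_mem_couplings
  obtain ⟨X', t, hrun, hround, hnear, ht⟩ := h.exists_sinkhornRuns_round hX hXc hε hε1
  have hM := h.exponent_nonneg
  obtain ⟨T, hT, hTle⟩ := EntropicOT.exists_approxOTRuns_of_sinkhornRuns (by positivity) hrun ht
  refine ⟨_, _, T, fun Z => EntropicOT.isOptimal_iff_eq_extend hr.1 hc.1 fun Y =>
    EntropicOT.isOptimal_iff_of_isScaling hξ hX hXc h.row_mem.2, hT,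
    EntropicOT.extend_mem_couplings hr.1 hc.1 hround, ?_, hTle.trans ?_⟩
  · rwa [EntropicOT.norm1_extend_sub_extend]
  · rw [← mul_pow]
    linarith [mul_nonneg (Nat.cast_nonneg (α := ℝ) m) (Nat.cast_nonneg n)]

theorem mainTheorem9 :
    ∃ (A : ℝ) (p : ℕ),
      ∀ (m n : ℕ) (r : Fin m → ℝ) (c : Fin n → ℝ) (C : Fin m → Fin n → ℝ) (ξ ε : ℝ),
        r ∈ stdSimplex ℝ (Fin m) → c ∈ stdSimplex ℝ (Fin n) →
        (∀ i, 0 < r i) → (∀ j, 0 < c j) → (∀ i j, 0 ≤ C i j) → 0 < ξ → 0 < ε → ε < 1 →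
        ∃ (Xopt Xhat : Fin m → Fin n → ℝ) (T : ℕ),
          (∀ X, EntropicOT.IsOptimal r c C ξ X ↔ X = Xopt) ∧
          EntropicOT.ApproxOTRuns r c C ξ ε Xhat T ∧
          Xhat ∈ EntropicOT.couplings r c ∧
          EntropicOT.norm1 (fun i j => Xhat i j - Xopt i j) ≤ ε ∧
          (T : ℝ) ≤ A * (1 + Real.log ((m : ℝ) * n)) ^ p *
            ((m : ℝ) * n * (ε ^ 4)⁻¹ * (ξ * EntropicOT.normInf C) *
                (ξ ^ 2 * EntropicOT.normInf C ^ 2 +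
                  Real.log (EntropicOT.minEntry r c)⁻¹ ^ 2) +
              (m : ℝ) * n) := by
  refine ⟨63488, 0, fun m n r c C ξ ε hr hc hr0 hc0 hC hξ hε hε1 => ?_⟩
  simpa only [EntropicOT.normInf_restrict hr0 hc0, EntropicOT.minEntry_support hr0 hc0, pow_zero,
    mul_one] using mainTheorem9_general hr hc hC hξ hε hε1
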